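/- Let $f$ be a probability density on $\mathbb{R}$ which vanishes on $(-\infty,0)$ and is positive and $C^3$ on $(0,\infty)$. Let $A>0$ and $\kappa>0$, and write $g(x)\cong h(x)$ if $g(x)/h(x)\to 1$. Assume, as $x\to+0$: $f(x)\cong A x^{\kappa-1}$; if $\kappa\neq 1$, $f'(x)\cong A(\kappa-1)x^{\kappa-2}$; if $\kappa\notin\{1,2\}$, $f''(x)\cong A(\kappa-1)(\kappa-2)x^{\kappa-3}$; if $\kappa=2$, $x f''(x)\to 0$; if $\kappa=1$, the finite limits $\lim_{x\to+0}f'(x)$ and $\lim_{x\to+0}f''(x)$ exist. Assume also that there are $c>0$ and $\delta>0$ with $\int_c^\infty \frac{f'(x)^2}{f(x)}\,dx<\infty$ and $$\int_c^\infty \sup_{0\le t\le\delta} f(x+t)\,\sup_{0\le t\le\delta}|h(x+t)|\,dx<\infty\quad\text{for } h=\frac{(f')^3}{f^3},\ h=\frac{f'f''}{f^2},\ h=\frac{f'''}{f}.$$ For $0<s<1$ let $I^s(p\|q)=-\log\int_{\mathbb{R}} p(x)^s q(x)^{1-s}\,dx$ be the relative Rényi entropy of the densities $p,q$, let $f_\theta(x)=f(x-\theta)$,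 let $J_f=\int_0^\infty \frac{f'(x)^2}{f(x)}\,dx$, and let $B$ be the beta function. Then for every $\theta\in\mathbb{R}$ $$\lim_{\epsilon\to+0}\frac{I^s(f_\theta\|f_{\theta+\epsilon})}{\epsilon^\kappa}=\begin{cases}\frac{1-\kappa}{\kappa}\,A s\,B(s+\kappa(1-s),1-\kappa), & 0<\kappa<1,\\ A s, & \kappa=1,\\ \frac{1}{\kappa}\,A s\,(1-s(\kappa-1))\,B(s+\kappa(1-s),2-\kappa), & 1<\kappa<2,\end{cases}$$ $$\lim_{\epsilon\to+0}\frac{I^s(f_\theta\|f_{\theta+\epsilon})}{-\epsilon^2\log\epsilon}=\frac{A s(1-s)}{2}\quad\text{if }\kappa=2,$$ $$J_f<\infty\quad\text{and}\quad\lim_{\epsilon\to+0}\frac{I^s(f_\theta\|f_{\theta+\epsilon})}{\epsilon^2}=\frac{s(1-s)}{2}J_f\quad\text{if }\kappa>2,$$ and all these convergences are uniform in $s\in(0,1)$. Moreover, for all $\alpha,\beta>0$ the assumptions are satisfied by the Weibull density $\alpha\beta x^{\alpha-1}e^{-\beta x^\alpha}$ $(x>0)$ with $\kappa=\alpha$,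 $A=\alpha\beta$, and by the gamma density $\frac{\beta^\alpha}{\Gamma(\alpha)}x^{\alpha-1}e^{-\beta x}$ $(x>0)$ with $\kappa=\alpha$, $A=\frac{\beta^\alpha}{\Gamma(\alpha)}$. -/

import Mathlib

open Filter Topology Asymptotics MeasureTheory Set

namespace LocationShift

/-- The relative Rényi entropy `I^s(p‖q) = -log ∫ p^s q^(1-s)` of two densities on the real line.
For probability densities and `0 < s < 1` the integrand is integrable (it is at most
`s p + (1-s) q`). -/
noncomputable def relRenyi (s : ℝ) (p q : ℝ → ℝ) : ℝ :=
  -Real.log (∫ x, p x ^ s * q x ^ (1 - s))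

/-- The member `f_θ(x) = f(x - θ)` of the location-shift family generated by `f`. -/
def shift (f : ℝ → ℝ) (θ : ℝ) : ℝ → ℝ := fun x => f (x - θ)

/-- `f` is a probability density whose support is the half-line `(0,∞)` and which is
`C³` there. -/
structure IsHalfLineDensity (f : ℝ → ℝ) : Prop where
  nonneg : ∀ x, 0 ≤ f x
  eq_zero : ∀ x, x < 0 → f x = 0
  pos : ∀ x, 0 < x → 0 < f x
  integrable : Integrable f
  integral_eq_one : ∫ x, f x = 1
  contDiffOn : ContDiffOn ℝ 3 f (Ioi 0)

/-- The behaviour of `f` at the endpoint `0`, of order `κ > 0` with coefficient `A > 0`. -/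
structure EndpointCondition (f : ℝ → ℝ) (A κ : ℝ) : Prop where
  A_pos : 0 < A
  kappa_pos : 0 < κ
  equiv : f ~[𝓝[>] 0] fun x => A * x ^ (κ - 1)
  equiv_deriv : κ ≠ 1 → deriv f ~[𝓝[>] 0] fun x => A * (κ - 1) * x ^ (κ - 2)
  equiv_deriv2 : κ ≠ 1 → κ ≠ 2 →
    iteratedDeriv 2 f ~[𝓝[>] 0] fun x => A * (κ - 1) * (κ - 2) * x ^ (κ - 3)
  tendsto_of_two : κ = 2 → Tendsto (fun x => x * iteratedDeriv 2 f x) (𝓝[>] 0) (𝓝 0)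
  limit_deriv_of_one : κ = 1 → ∃ l : ℝ, Tendsto (deriv f) (𝓝[>] 0) (𝓝 l)
  limit_deriv2_of_one : κ = 1 → ∃ l : ℝ, Tendsto (iteratedDeriv 2 f) (𝓝[>] 0) (𝓝 l)

/-- `sup_{0 ≤ t ≤ δ} g(x + t)`. -/
noncomputable def supShift (δ : ℝ) (g : ℝ → ℝ) (x : ℝ) : ℝ :=
  ⨆ t : Icc (0 : ℝ) δ, g (x + t)

/-- The integrability conditions on the tail of `f`. All integrands are nonnegative, and
continuous on `(c,∞)` for a positive `C³` function `f`, so that integrability is finiteness of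
the integral. -/
def TailCondition (f : ℝ → ℝ) : Prop :=
  ∃ c : ℝ, 0 < c ∧ ∃ δ : ℝ, 0 < δ ∧
    IntegrableOn (fun x => (f x)⁻¹ * deriv f x ^ 2) (Ioi c) ∧
    IntegrableOn (fun x => supShift δ f x *
      supShift δ (fun y => |(f y ^ 3)⁻¹ * deriv f y ^ 3|) x) (Ioi c) ∧
    IntegrableOn (fun x => supShift δ f x *
      supShift δ (fun y => |(f y ^ 2)⁻¹ * deriv f y * iteratedDeriv 2 f y|) x) (Ioi c) ∧
    IntegrableOn (fun x => supShift δ f x *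
      supShift δ (fun y => |(f y)⁻¹ * iteratedDeriv 3 f y|) x) (Ioi c)

/-- The standing assumptions on the generating density. -/
structure Admissible (f : ℝ → ℝ) (A κ : ℝ) : Prop where
  density : IsHalfLineDensity f
  endpoint : EndpointCondition f A κ
  tail : TailCondition f

/-- The Fisher information `J_f = ∫_0^∞ f⁻¹ (f')²`. -/
noncomputable def fisherInfo (f : ℝ → ℝ) : ℝ :=
  ∫ x in Ioi (0 : ℝ), (f x)⁻¹ * deriv f x ^ 2

/-- The density `α β x^(α-1) exp(-β x^α)` on the half-line of the Weibull distribution. -/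
noncomputable def weibullPDF (α β x : ℝ) : ℝ :=
  if 0 ≤ x then α * β * x ^ (α - 1) * Real.exp (-(β * x ^ α)) else 0

/-- `R ε s → L s` as `ε → +0`, uniformly for `0 < s < 1`. -/
def UniformLimit (R : ℝ → ℝ → ℝ) (L : ℝ → ℝ) : Prop :=
  TendstoUniformlyOn R L (𝓝[>] 0) (Ioo 0 1)

end LocationShift

/-!
Since `-log` has slope `-1` at `1`, the relative entropy may be replaced by the deficit
`1 - ∫ f (x + ε) ^ s * f x ^ (1 - s)`. Splitting `1` as the `s`-weighted mean of `∫ f` over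
`(0, ∞)` with itself, the deficit becomes `s` times the mass of `(0, ε)` plus the integral over the
half-line of the gap between the weighted arithmetic and geometric means of `f (x + ε)` and `f x`.
A Taylor expansion in `ε` shows that any tail `(η, ∞)` contributes
`ε ^ 2 * s * (1 - s) / 2 * ∫ f'² / f` to first order. For `κ < 2` the endpoint dominates: after
the substitution `x = ε * y` the gap integral is asymptotic to `A * ε ^ κ` times that of the power
`y ^ (κ - 1)`, which an explicit primitive reduces to a beta integral. For `κ > 2` the expansion of
the tail is valid up to the endpoint, and at `κ = 2` the Fisher integrand is asymptotic to `A / x`,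
which produces the logarithm.
-/

namespace LocationShift

/-! ### The gap between weighted means -/

/-- The gap between the weighted arithmetic and geometric means of `a` and `b`; integrated over
`a = p x` and `b = q x` it measures how far `∫ p ^ s * q ^ (1 - s)` is from `1`. -/
noncomputable def meanGap (s a b : ℝ) : ℝ := s * a + (1 - s) * b - a ^ s * b ^ (1 - s)

section MeanGap

variable {s a b : ℝ} (hs : s ∈ Ioo (0 : ℝ) 1)
include hs

lemma meanGap_nonneg (ha : 0 ≤ a) (hb : 0 ≤ b) : 0 ≤ meanGap s a b :=
  sub_nonneg.2 <|
    Real.geom_mean_le_arith_mean2_weighted hs.1.le (sub_nonneg.2 hs.2.le) ha hb (by ring)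

lemma meanGap_le_add (ha : 0 ≤ a) (hb : 0 ≤ b) : meanGap s a b ≤ a + b := by
  have hG : 0 ≤ a ^ s * b ^ (1 - s) := by positivity
  have hsa : s * a ≤ a := mul_le_of_le_one_left ha hs.2.le
  have hsb : (1 - s) * b ≤ b := mul_le_of_le_one_left hb (by linarith [hs.1])
  unfold meanGap
  linarith

lemma harm_mean_le_geom_mean2_weighted (ha : 0 < a) (hb : 0 < b) :
    a * b / (s * b + (1 - s) * a) ≤ a ^ s * b ^ (1 - s) := by
  have hs' : 0 < 1 - s := sub_pos.2 hs.2
  have hs0 := hs.1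
  have h := Real.geom_mean_le_arith_mean2_weighted hs0.le hs'.le
    (inv_nonneg.2 ha.le) (inv_nonneg.2 hb.le) (by ring)
  rw [Real.inv_rpow ha.le, Real.inv_rpow hb.le, ← mul_inv,
    show s * a⁻¹ + (1 - s) * b⁻¹ = (a * b / (s * b + (1 - s) * a))⁻¹ by field_simp] at h
  exact (inv_le_inv₀ (by positivity) (by positivity)).1 h

lemma meanGap_le_sq_div (ha : 0 < a) (hb : 0 < b) :
    meanGap s a b ≤ s * (1 - s) * (a - b) ^ 2 / (s * b + (1 - s) * a) := by
  have hs' : 0 < 1 - s := sub_pos.2 hs.2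
  have hs0 := hs.1
  calc meanGap s a b ≤ s * a + (1 - s) * b - a * b / (s * b + (1 - s) * a) :=
        sub_le_sub_left (harm_mean_le_geom_mean2_weighted hs ha hb) _
    _ = s * (1 - s) * (a - b) ^ 2 / (s * b + (1 - s) * a) := by
        field_simp
        ring

lemma meanGap_le_sq_div_of_le {m : ℝ} (hm : 0 < m) (ha : m ≤ a) (hb : m ≤ b) :
    meanGap s a b ≤ (a - b) ^ 2 / m := by
  obtain ⟨hs0, hs1⟩ := hs
  have hmean : m ≤ s * b + (1 - s) * a := by nlinarith
  have hss : s * (1 - s) ≤ 1 := by nlinarith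
  refine (meanGap_le_sq_div ⟨hs0, hs1⟩ (hm.trans_le ha) (hm.trans_le hb)).trans ?_
  gcongr
  exact mul_le_of_le_one_left (sq_nonneg _) hss

lemma abs_rpow_mul_rpow_sub_one_le (ha : 0 ≤ a) (hb : 0 ≤ b) :
    |a ^ s * b ^ (1 - s) - 1| ≤ |a - 1| + |b - 1| := by
  have hs' : 0 ≤ 1 - s := sub_nonneg.2 hs.2.le
  have ha' := abs_nonneg (a - 1)
  have hb' := abs_nonneg (b - 1)
  refine abs_le.2 ⟨?_, ?_⟩
  · rcases le_total (1 - (|a - 1| + |b - 1|)) 0 with hm | hm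
    · have : 0 ≤ a ^ s * b ^ (1 - s) := by positivity
      linarith
    · set m := 1 - (|a - 1| + |b - 1|)
      have hma : m ≤ a := by linarith [neg_abs_le (a - 1)]
      have hmb : m ≤ b := by linarith [neg_abs_le (b - 1)]
      have : m ≤ a ^ s * b ^ (1 - s) := calc
        m = m ^ s * m ^ (1 - s) := by rw [← Real.rpow_add' hm (by simp)]; simp
        _ ≤ a ^ s * b ^ (1 - s) := by gcongr; exact hs.1.le
      linarith
  · have := meanGap_nonneg hs ha hb
    unfold meanGap at this
    nlinarith [le_abs_self (a - 1), le_abs_self (b - 1), hs.1]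

lemma abs_meanGap_sub_meanGap_le {u v : ℝ} (ha : 0 < a) (hb : 0 < b) (hu : 0 ≤ u) (hv : 0 ≤ v) :
    |meanGap s u v - meanGap s a b| ≤
      |u - a| + |v - b| + (a + b) * (|u / a - 1| + |v / b - 1|) := by
  have hs' : 0 ≤ 1 - s := sub_nonneg.2 hs.2.le
  have hG : a ^ s * b ^ (1 - s) ≤ a + b := by
    have := meanGap_nonneg hs ha.le hb.le
    unfold meanGap at this
    nlinarith [hs.1]
  have hfactor : u ^ s * v ^ (1 - s) =
      a ^ s * b ^ (1 - s) * ((u / a) ^ s * (v / b) ^ (1 - s)) := by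
    rw [Real.div_rpow hu ha.le, Real.div_rpow hv hb.le]
    field_simp
  have hsplit : meanGap s u v - meanGap s a b = s * (u - a) + (1 - s) * (v - b) -
      a ^ s * b ^ (1 - s) * ((u / a) ^ s * (v / b) ^ (1 - s) - 1) := by
    unfold meanGap
    rw [hfactor]
    ring
  rw [hsplit]
  refine (abs_sub _ _).trans (add_le_add ((abs_add_le _ _).trans (add_le_add ?_ ?_)) ?_)
  · rw [abs_mul, abs_of_pos hs.1]
    exact mul_le_of_le_one_left (abs_nonneg _) hs.2.le
  · rw [abs_mul, abs_of_nonneg hs']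
    exact mul_le_of_le_one_left (abs_nonneg _) (by linarith [hs.1])
  · rw [abs_mul, abs_of_nonneg (by positivity)]
    gcongr
    exact abs_rpow_mul_rpow_sub_one_le hs (by positivity) (by positivity)

end MeanGap

lemma meanGap_mul {s a b c : ℝ} (hc : 0 ≤ c) (ha : 0 ≤ a) (hb : 0 ≤ b) :
    meanGap s (c * a) (c * b) = c * meanGap s a b := by
  have hcc : c ^ s * c ^ (1 - s) = c := by
    rw [← Real.rpow_add' hc (by simp)]
    simp
  unfold meanGap
  rw [Real.mul_rpow hc ha, Real.mul_rpow hc hb]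
  linear_combination (-a ^ s * b ^ (1 - s)) * hcc

lemma tendsto_meanGap_sub_meanGap {ι : Type*} {l : Filter ι} {s u v : ι → ℝ} {a b : ℝ}
    (hs : ∀ᶠ i in l, s i ∈ Ioo (0 : ℝ) 1) (ha : 0 < a) (hb : 0 < b)
    (hu : Tendsto u l (𝓝 a)) (hv : Tendsto v l (𝓝 b)) :
    Tendsto (fun i => meanGap (s i) (u i) (v i) - meanGap (s i) a b) l (𝓝 0) := by
  have hbound : Tendsto (fun i => |u i - a| + |v i - b| + (a + b) * (|u i / a - 1| + |v i / b - 1|))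
      l (𝓝 0) := by
    have := ((hu.sub_const a).abs.add (hv.sub_const b).abs).add
      ((((hu.div_const a).sub_const 1).abs.add
        ((hv.div_const b).sub_const 1).abs).const_mul (a + b))
    simpa [ha.ne', hb.ne'] using this
  refine squeeze_zero_norm' ?_ hbound
  filter_upwards [hs, hu.eventually (lt_mem_nhds ha), hv.eventually (lt_mem_nhds hb)]
    with i hsi hui hvi
  exact abs_meanGap_sub_meanGap_le hsi ha hb hui.le hvi.le

lemma integrable_geom_mean {α : Type*} [MeasurableSpace α] {μ : Measure α} {s : ℝ}
    (hs : s ∈ Ioo (0 : ℝ) 1) {p q : α → ℝ} (hp : Integrable p μ) (hq : Integrable q μ)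
    (hp0 : ∀ x, 0 ≤ p x) (hq0 : ∀ x, 0 ≤ q x) :
    Integrable (fun x => p x ^ s * q x ^ (1 - s)) μ := by
  refine ((hp.const_mul s).add (hq.const_mul (1 - s))).mono'
    ((hp.aemeasurable.pow_const s).mul (hq.aemeasurable.pow_const (1 - s))).aestronglyMeasurable
    (Eventually.of_forall fun x => ?_)
  have hpx := hp0 x
  have hqx := hq0 x
  rw [Real.norm_of_nonneg (by positivity)]
  exact sub_nonneg.1 (meanGap_nonneg hs hpx hqx)

lemma integrable_meanGap {α : Type*} [MeasurableSpace α] {μ : Measure α} {s : ℝ}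
    (hs : s ∈ Ioo (0 : ℝ) 1) {p q : α → ℝ} (hp : Integrable p μ) (hq : Integrable q μ)
    (hp0 : ∀ x, 0 ≤ p x) (hq0 : ∀ x, 0 ≤ q x) :
    Integrable (fun x => meanGap s (p x) (q x)) μ :=
  ((hp.const_mul s).add (hq.const_mul (1 - s))).sub (integrable_geom_mean hs hp hq hp0 hq0)

/-! ### Taylor estimates -/

section IteratedDeriv

variable {f : ℝ → ℝ} {U : Set ℝ} {n k : ℕ}

lemma hasDerivAt_iteratedDeriv (hf : ContDiffOn ℝ n f U) (hU : IsOpen U) (hk : k < n) {x : ℝ}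
    (hx : x ∈ U) : HasDerivAt (iteratedDeriv k f) (iteratedDeriv (k + 1) f x) x := by
  have hdiff : DifferentiableOn ℝ (iteratedDeriv k f) U :=
    (hf.differentiableOn_iteratedDerivWithin (by exact_mod_cast hk) hU.uniqueDiffOn).congr
      fun _ hy => (iteratedDerivWithin_of_isOpen hU hy).symm
  rw [iteratedDeriv_succ]
  exact (hdiff.differentiableAt (hU.mem_nhds hx)).hasDerivAt

lemma continuousOn_iteratedDeriv (hf : ContDiffOn ℝ n f U) (hU : IsOpen U) (hk : k ≤ n) :
    ContinuousOn (iteratedDeriv k f) U :=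
  (hf.continuousOn_iteratedDerivWithin (by exact_mod_cast hk) hU.uniqueDiffOn).congr
    fun _ hx => (iteratedDerivWithin_of_isOpen hU hx).symm

end IteratedDeriv

section TaylorBound

variable {φ φ₁ φ₂ φ₃ : ℝ → ℝ} {ε M t : ℝ}

lemma abs_sub_le_of_abs_deriv_le_pow {k : ℕ} (hφ : ∀ t ∈ Icc 0 ε, HasDerivAt φ (φ₁ t) t)
    (hM : ∀ t ∈ Icc 0 ε, |φ₁ t| ≤ M * t ^ k) (ht : t ∈ Icc 0 ε) :
    |φ t - φ 0| ≤ M / (k + 1) * t ^ (k + 1) := by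
  have hB : ∀ t, HasDerivAt (fun t => M / (k + 1) * t ^ (k + 1)) (M * t ^ k) t := fun t => by
    have hk : (k : ℝ) + 1 ≠ 0 := by positivity
    convert! (hasDerivAt_pow (k + 1) t).const_mul (M / (k + 1)) using 1
    push_cast
    field_simp
  exact image_norm_le_of_norm_deriv_right_le_deriv_boundary
    (f := fun t => φ t - φ 0) (f' := φ₁) (a := 0) (b := ε)
    (B := fun t => M / (k + 1) * t ^ (k + 1)) (B' := fun t => M * t ^ k)
    (fun t ht => ((hφ t ht).sub_const _).continuousAt.continuousWithinAt)
    (fun t ht => ((hφ t ⟨ht.1, ht.2.le⟩).sub_const _).hasDerivWithinAt)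
    (by simp) hB (fun t ht => hM t ⟨ht.1, ht.2.le⟩) ht

lemma abs_taylor_two_sub_le (h₀ : φ 0 = 0) (h₁ : φ₁ 0 = 0)
    (hφ : ∀ t ∈ Icc 0 ε, HasDerivAt φ (φ₁ t) t) (hφ₁ : ∀ t ∈ Icc 0 ε, HasDerivAt φ₁ (φ₂ t) t)
    (hφ₂ : ∀ t ∈ Icc 0 ε, HasDerivAt φ₂ (φ₃ t) t) (hM : ∀ t ∈ Icc 0 ε, |φ₃ t| ≤ M)
    (ht : t ∈ Icc 0 ε) : |φ t - φ₂ 0 / 2 * t ^ 2| ≤ M / 6 * t ^ 3 := by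
  have bound₂ : ∀ t ∈ Icc 0 ε, |φ₂ t - φ₂ 0| ≤ M * t ^ 1 := fun t ht => by
    simpa using abs_sub_le_of_abs_deriv_le_pow (k := 0) (M := M) hφ₂ (by simpa using hM) ht
  have bound₁ : ∀ t ∈ Icc 0 ε, |φ₁ t - φ₂ 0 * t| ≤ M / 2 * t ^ 2 := fun t ht => by
    have := abs_sub_le_of_abs_deriv_le_pow (φ := fun t => φ₁ t - φ₂ 0 * t)
      (fun t ht => (hφ₁ t ht).sub (by simpa using (hasDerivAt_id t).const_mul (φ₂ 0))) bound₂ ht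
    norm_num [h₁] at this ⊢
    exact this
  have hquad : ∀ t, HasDerivAt (fun t => φ₂ 0 / 2 * t ^ 2) (φ₂ 0 * t) t := fun t => by
    convert! (hasDerivAt_pow 2 t).const_mul (φ₂ 0 / 2) using 1
    push_cast
    ring
  have := abs_sub_le_of_abs_deriv_le_pow (φ := fun t => φ t - φ₂ 0 / 2 * t ^ 2)
    (fun t ht => (hφ t ht).sub (hquad t)) bound₁ ht
  norm_num [h₀] at this ⊢
  exact this.trans_eq (by ring)

end TaylorBound

section MeanGapTaylor

variable {s : ℝ}

lemma abs_rpow_third_deriv_factor_le (hs : s ∈ Ioo (0 : ℝ) 1) (h₁ h₂ h₃ : ℝ) :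
    |s * h₃ - 3 * (s * (1 - s)) * (h₁ * h₂) + s * (1 - s) * (2 - s) * h₁ ^ 3| ≤
      |h₁ ^ 3| + |h₁ * h₂| + |h₃| := by
  obtain ⟨hs0, hs1⟩ := hs
  have hs' : 0 ≤ s * (1 - s) := mul_nonneg hs0.le (by linarith)
  have hquarter : s * (1 - s) ≤ 1 / 4 := by nlinarith [sq_nonneg (s - 1 / 2)]
  have term₃ : |s * h₃| ≤ |h₃| := by
    rw [abs_mul, abs_of_pos hs0]
    exact mul_le_of_le_one_left (abs_nonneg _) hs1.le
  have term₂ : |3 * (s * (1 - s)) * (h₁ * h₂)| ≤ |h₁ * h₂| := by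
    rw [abs_mul, abs_of_nonneg (by positivity)]
    exact mul_le_of_le_one_left (abs_nonneg _) (by linarith)
  have term₁ : |s * (1 - s) * (2 - s) * h₁ ^ 3| ≤ |h₁ ^ 3| := by
    rw [abs_mul, abs_of_nonneg (mul_nonneg hs' (by linarith))]
    exact mul_le_of_le_one_left (abs_nonneg _) (by nlinarith)
  linarith [abs_add_le (s * h₃ - 3 * (s * (1 - s)) * (h₁ * h₂)) (s * (1 - s) * (2 - s) * h₁ ^ 3),
    abs_sub (s * h₃) (3 * (s * (1 - s)) * (h₁ * h₂))]

section Curve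

variable {g g₁ g₂ g₃ : ℝ → ℝ} {b t : ℝ}

lemma hasDerivAt_meanGap (hpos : 0 < g t) (hg : HasDerivAt g (g₁ t) t) :
    HasDerivAt (fun t => meanGap s (g t) b)
      (s * g₁ t - s * (g₁ t / g t) * (g t ^ s * b ^ (1 - s))) t := by
  convert! ((hg.const_mul s).add_const ((1 - s) * b)).sub
    ((hg.rpow_const (p := s) (Or.inl hpos.ne')).mul_const (b ^ (1 - s))) using 1
  rw [Real.rpow_sub_one hpos.ne']
  ring

lemma hasDerivAt_meanGap_deriv (hpos : 0 < g t) (hg : HasDerivAt g (g₁ t) t)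
    (hg₁ : HasDerivAt g₁ (g₂ t) t) :
    HasDerivAt (fun t => s * g₁ t - s * (g₁ t / g t) * (g t ^ s * b ^ (1 - s)))
      (s * g₂ t - (s * (g₂ t / g t) - s * (1 - s) * (g₁ t / g t) ^ 2) *
        (g t ^ s * b ^ (1 - s))) t := by
  convert! (hg₁.const_mul s).sub (((hg₁.div hg hpos.ne').const_mul s).mul
    ((hg.rpow_const (p := s) (Or.inl hpos.ne')).mul_const (b ^ (1 - s)))) using 1
  rw [Real.rpow_sub_one hpos.ne', Pi.div_apply]
  field_simp
  ring

lemma hasDerivAt_meanGap_deriv_deriv (hpos : 0 < g t) (hg : HasDerivAt g (g₁ t) t)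
    (hg₁ : HasDerivAt g₁ (g₂ t) t) (hg₂ : HasDerivAt g₂ (g₃ t) t) :
    HasDerivAt (fun t => s * g₂ t - (s * (g₂ t / g t) - s * (1 - s) * (g₁ t / g t) ^ 2) *
        (g t ^ s * b ^ (1 - s)))
      (s * g₃ t - (s * (g₃ t / g t) - 3 * (s * (1 - s)) * (g₁ t / g t * (g₂ t / g t)) +
        s * (1 - s) * (2 - s) * (g₁ t / g t) ^ 3) * (g t ^ s * b ^ (1 - s))) t := by
  convert! (hg₂.const_mul s).sub ((((hg₂.fun_div hg hpos.ne').const_mul s).fun_sub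
    (((hg₁.fun_div hg hpos.ne').fun_pow 2).const_mul (s * (1 - s)))).mul
    ((hg.rpow_const (p := s) (Or.inl hpos.ne')).mul_const (b ^ (1 - s)))) using 1
  rw [Real.rpow_sub_one hpos.ne', Nat.add_one_sub_one, pow_one, Nat.cast_two]
  field_simp
  ring

end Curve

lemma abs_meanGap_third_deriv_le {a b d₁ d₂ d₃ S H₁ H₂ H₃ : ℝ} (hs : s ∈ Ioo (0 : ℝ) 1)
    (ha : 0 < a) (hb : 0 < b) (haS : a ≤ S) (hbS : b ≤ S) (hH₁ : |(a ^ 3)⁻¹ * d₁ ^ 3| ≤ H₁)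
    (hH₂ : |(a ^ 2)⁻¹ * d₁ * d₂| ≤ H₂) (hH₃ : |a⁻¹ * d₃| ≤ H₃) :
    |s * d₃ - (s * (d₃ / a) - 3 * (s * (1 - s)) * (d₁ / a * (d₂ / a)) +
      s * (1 - s) * (2 - s) * (d₁ / a) ^ 3) * (a ^ s * b ^ (1 - s))| ≤
      2 * (S * (H₁ + H₂ + H₃)) := by
  have hbound₁ : |(d₁ / a) ^ 3| ≤ H₁ := (congrArg _ (by field_simp)).trans_le hH₁
  have hbound₂ : |d₁ / a * (d₂ / a)| ≤ H₂ := (congrArg _ (by field_simp)).trans_le hH₂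
  have hbound₃ : |d₃ / a| ≤ H₃ := (congrArg _ (by field_simp)).trans_le hH₃
  have hS : 0 ≤ S := hb.le.trans hbS
  have hmean : a ^ s * b ^ (1 - s) ≤ S := by
    have := meanGap_nonneg hs ha.le hb.le
    unfold meanGap at this
    nlinarith [hs.1, hs.2]
  have hsd₃ : |s * d₃| ≤ S * H₃ := calc
    |s * d₃| = s * (a * |d₃ / a|) := by
      rw [abs_mul, abs_of_pos hs.1, abs_div, abs_of_pos ha, mul_div_cancel₀ _ ha.ne']
    _ ≤ 1 * (S * H₃) := by
      gcongr
      exact hs.2.le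
    _ = S * H₃ := one_mul _
  have hfactor := (abs_rpow_third_deriv_factor_le hs (d₁ / a) (d₂ / a) (d₃ / a)).trans
    (add_le_add_three hbound₁ hbound₂ hbound₃)
  have hprod := mul_le_mul hfactor hmean (by positivity) ((abs_nonneg _).trans hfactor)
  refine (abs_sub _ _).trans ?_
  rw [abs_mul _ (a ^ s * _), abs_of_nonneg (by positivity : 0 ≤ a ^ s * b ^ (1 - s))]
  linarith [mul_nonneg hS ((abs_nonneg _).trans hbound₁),
    mul_nonneg hS ((abs_nonneg _).trans hbound₂)]

lemma abs_meanGap_sub_sq_le {g g₁ g₂ g₃ : ℝ → ℝ} {ε S H₁ H₂ H₃ : ℝ} (hs : s ∈ Ioo (0 : ℝ) 1)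
    (hε : 0 ≤ ε) (hpos : ∀ t ∈ Icc 0 ε, 0 < g t)
    (hg : ∀ t ∈ Icc 0 ε, HasDerivAt g (g₁ t) t) (hg₁ : ∀ t ∈ Icc 0 ε, HasDerivAt g₁ (g₂ t) t)
    (hg₂ : ∀ t ∈ Icc 0 ε, HasDerivAt g₂ (g₃ t) t) (hS : ∀ t ∈ Icc 0 ε, g t ≤ S)
    (hH₁ : ∀ t ∈ Icc 0 ε, |(g t ^ 3)⁻¹ * g₁ t ^ 3| ≤ H₁)
    (hH₂ : ∀ t ∈ Icc 0 ε, |(g t ^ 2)⁻¹ * g₁ t * g₂ t| ≤ H₂)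
    (hH₃ : ∀ t ∈ Icc 0 ε, |(g t)⁻¹ * g₃ t| ≤ H₃) :
    |meanGap s (g ε) (g 0) - s * (1 - s) / 2 * ((g 0)⁻¹ * g₁ 0 ^ 2) * ε ^ 2| ≤
      S * (H₁ + H₂ + H₃) * ε ^ 3 := by
  have h0 : (0 : ℝ) ∈ Icc 0 ε := ⟨le_rfl, hε⟩
  have hg0 := hpos 0 h0
  have hG0 : g 0 ^ s * g 0 ^ (1 - s) = g 0 := by
    rw [← Real.rpow_add hg0]
    simp
  have hthird : ∀ t ∈ Icc 0 ε, |s * g₃ t - (s * (g₃ t / g t) - 3 * (s * (1 - s)) *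
      (g₁ t / g t * (g₂ t / g t)) + s * (1 - s) * (2 - s) * (g₁ t / g t) ^ 3) *
      (g t ^ s * g 0 ^ (1 - s))| ≤ 6 * (S * (H₁ + H₂ + H₃)) := fun t ht => by
    have hle := abs_meanGap_third_deriv_le hs (hpos t ht) hg0 (hS t ht) (hS 0 h0) (hH₁ t ht)
      (hH₂ t ht) (hH₃ t ht)
    linarith [(abs_nonneg _).trans hle]
  have := abs_taylor_two_sub_le (φ := fun t => meanGap s (g t) (g 0))
    (by simp only [meanGap, hG0]; ring) (by simp only [hG0]; field_simp; ring)
    (fun t ht => hasDerivAt_meanGap (hpos t ht) (hg t ht))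
    (fun t ht => hasDerivAt_meanGap_deriv (hpos t ht) (hg t ht) (hg₁ t ht))
    (fun t ht => hasDerivAt_meanGap_deriv_deriv (hpos t ht) (hg t ht) (hg₁ t ht) (hg₂ t ht))
    hthird (t := ε) ⟨hε, le_rfl⟩
  simp only [hG0] at this
  convert this using 2
  · field_simp
    ring
  · ring

lemma abs_meanGap_sub_sq_div_le {a b : ℝ} (hs : s ∈ Ioo (0 : ℝ) 1) (hb : 0 < b) (hab : b ≤ a) :
    |meanGap s a b - s * (1 - s) / 2 * ((a - b) ^ 2 / b)| ≤ a * ((a - b) / b) ^ 3 := by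
  have hle : ∀ t ∈ Icc 0 (a - b), |((b + t) ^ 3)⁻¹ * (1 : ℝ) ^ 3| ≤ (b ^ 3)⁻¹ := fun t ht => by
    have := ht.1
    rw [one_pow, mul_one, abs_of_pos (by positivity)]
    gcongr
    linarith
  have := abs_meanGap_sub_sq_le (g := fun t => b + t) (g₁ := fun _ => 1) (g₂ := fun _ => 0)
    (g₃ := fun _ => 0) (S := a) (H₂ := 0) (H₃ := 0) hs (sub_nonneg.2 hab)
    (fun t ht => by linarith [ht.1]) (fun t _ => (hasDerivAt_id t).const_add b)
    (fun t _ => hasDerivAt_const t 1) (fun t _ => hasDerivAt_const t 0)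
    (fun t ht => by linarith [ht.2]) hle (by simp) (by simp)
  convert! this using 1
  · simp only [add_sub_cancel, add_zero]
    ring_nf
  · ring

end MeanGapTaylor

/-! ### Suprema over shifts -/

lemma le_supShift {g : ℝ → ℝ} (hg : ContinuousOn g (Ioi 0)) {δ x t : ℝ} (hx : 0 < x)
    (ht : t ∈ Icc 0 δ) : g (x + t) ≤ supShift δ g x := by
  have hcont : ContinuousOn (fun t => g (x + t)) (Icc 0 δ) :=
    hg.comp (by fun_prop) fun t ht => add_pos_of_pos_of_nonneg hx ht.1
  have hbdd : BddAbove (range fun t : Icc (0 : ℝ) δ => g (x + t)) := by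
    refine (isCompact_Icc.image_of_continuousOn hcont).bddAbove.mono ?_
    rintro _ ⟨t, rfl⟩
    exact ⟨t, t.2, rfl⟩
  exact le_ciSup hbdd ⟨t, ht⟩

lemma continuousOn_supShift {g : ℝ → ℝ} (hg : ContinuousOn g (Ioi 0)) (δ : ℝ) :
    ContinuousOn (supShift δ g) (Ioi 0) := by
  rw [continuousOn_iff_continuous_domRestrict]
  have hcont : Continuous fun z : Ioi (0 : ℝ) × Icc (0 : ℝ) δ => g (z.1 + z.2) :=
    hg.comp_continuous (by fun_prop) fun z => add_pos_of_pos_of_nonneg z.1.2 z.2.2.1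
  convert! (isCompact_univ (X := Icc (0 : ℝ) δ)).continuous_sSup
    (f := fun (x : Ioi (0 : ℝ)) (t : Icc (0 : ℝ) δ) => g (x + t)) hcont using 2 with x
  simp only [domRestrict_apply, supShift, image_univ, sSup_range]

lemma integrableOn_Ioi_of_continuousOn {g : ℝ → ℝ} {a b c : ℝ} (hg : ContinuousOn g (Ioi a))
    (hc : IntegrableOn g (Ioi c)) (hab : a < b) : IntegrableOn g (Ioi b) := by
  have hIcc : IntegrableOn g (Icc b c) :=
    (hg.mono fun x hx => hab.trans_le hx.1).integrableOn_Icc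
  refine (hIcc.union hc).mono_set fun x hx => ?_
  exact (le_or_gt x c).imp (fun hxc => ⟨(mem_Ioi.1 hx).le, hxc⟩) id

/-! ### The tail of the gap integral -/

namespace IsHalfLineDensity

variable {f : ℝ → ℝ} (hf : IsHalfLineDensity f)
include hf

lemma continuousOn : ContinuousOn f (Ioi 0) := hf.contDiffOn.continuousOn

lemma continuousOn_deriv : ContinuousOn (deriv f) (Ioi 0) := by
  simpa only [iteratedDeriv_one] using
    continuousOn_iteratedDeriv (n := 3) (k := 1) hf.contDiffOn isOpen_Ioi (by norm_num)

lemma hasDerivAt {x : ℝ} (hx : 0 < x) : HasDerivAt f (deriv f x) x := by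
  simpa only [iteratedDeriv_zero, zero_add, iteratedDeriv_one] using
    hasDerivAt_iteratedDeriv (n := 3) (k := 0) hf.contDiffOn isOpen_Ioi (by norm_num) hx

lemma hasDerivAt_deriv {x : ℝ} (hx : 0 < x) :
    HasDerivAt (deriv f) (iteratedDeriv 2 f x) x := by
  simpa only [iteratedDeriv_one] using
    hasDerivAt_iteratedDeriv (n := 3) (k := 1) hf.contDiffOn isOpen_Ioi (by norm_num) hx

lemma continuousOn_inv_mul_deriv_sq :
    ContinuousOn (fun x => (f x)⁻¹ * deriv f x ^ 2) (Ioi 0) :=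
  (hf.continuousOn.inv₀ fun x hx => (hf.pos x hx).ne').mul (hf.continuousOn_deriv.pow 2)

lemma continuousOn_abs_deriv_pow_three :
    ContinuousOn (fun x => |(f x ^ 3)⁻¹ * deriv f x ^ 3|) (Ioi 0) :=
  (((hf.continuousOn.pow 3).inv₀ fun x hx => (pow_pos (hf.pos x hx) 3).ne').mul
    (hf.continuousOn_deriv.pow 3)).abs

lemma continuousOn_abs_deriv_mul_deriv_two :
    ContinuousOn (fun x => |(f x ^ 2)⁻¹ * deriv f x * iteratedDeriv 2 f x|) (Ioi 0) :=
  ((((hf.continuousOn.pow 2).inv₀ fun x hx => (pow_pos (hf.pos x hx) 2).ne').mul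
    hf.continuousOn_deriv).mul
    (continuousOn_iteratedDeriv (n := 3) hf.contDiffOn isOpen_Ioi (by norm_num))).abs

lemma continuousOn_abs_deriv_three :
    ContinuousOn (fun x => |(f x)⁻¹ * iteratedDeriv 3 f x|) (Ioi 0) :=
  ((hf.continuousOn.inv₀ fun x hx => (hf.pos x hx).ne').mul
    (continuousOn_iteratedDeriv (n := 3) hf.contDiffOn isOpen_Ioi le_rfl)).abs

end IsHalfLineDensity

/-- The gap between the weighted means of `f (x + ε)` and `f x`, whose integral over the half-line
is, up to the mass of `(0, ε]`, the deficit of the affinity of `f` and its shift by `ε`. -/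
noncomputable def shiftGap (f : ℝ → ℝ) (ε s x : ℝ) : ℝ := meanGap s (f (x + ε)) (f x)

section ShiftGap

variable {f : ℝ → ℝ} (hf : IsHalfLineDensity f) {ε s x : ℝ} (hs : s ∈ Ioo (0 : ℝ) 1)
include hf hs

lemma shiftGap_nonneg : 0 ≤ shiftGap f ε s x :=
  meanGap_nonneg hs (hf.nonneg _) (hf.nonneg _)

lemma shiftGap_le_add : shiftGap f ε s x ≤ f (x + ε) + f x :=
  meanGap_le_add hs (hf.nonneg _) (hf.nonneg _)

variable (ε) in
lemma integrable_shiftGap : Integrable (shiftGap f ε s) :=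
  integrable_meanGap hs (hf.integrable.comp_add_right ε) hf.integrable (fun _ => hf.nonneg _)
    hf.nonneg

lemma abs_shiftGap_sub_le {δ : ℝ} (hx : 0 < x) (hε : ε ∈ Icc 0 δ) :
    |shiftGap f ε s x - s * (1 - s) / 2 * ((f x)⁻¹ * deriv f x ^ 2) * ε ^ 2| ≤
      supShift δ f x * (supShift δ (fun y => |(f y ^ 3)⁻¹ * deriv f y ^ 3|) x +
        supShift δ (fun y => |(f y ^ 2)⁻¹ * deriv f y * iteratedDeriv 2 f y|) x +
        supShift δ (fun y => |(f y)⁻¹ * iteratedDeriv 3 f y|) x) * ε ^ 3 := by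
  have hpos : ∀ t ∈ Icc 0 ε, 0 < x + t := fun t ht => add_pos_of_pos_of_nonneg hx ht.1
  have hmem : ∀ t ∈ Icc 0 ε, t ∈ Icc 0 δ := fun t ht => ⟨ht.1, ht.2.trans hε.2⟩
  have hderiv : ∀ {g g' : ℝ → ℝ}, (∀ y, 0 < y → HasDerivAt g (g' y) y) →
      ∀ t ∈ Icc 0 ε, HasDerivAt (fun t => g (x + t)) (g' (x + t)) t := fun h t ht =>
    (h _ (hpos t ht)).comp_const_add x t
  have := abs_meanGap_sub_sq_le (g := fun t => f (x + t)) (g₁ := fun t => deriv f (x + t))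
    (g₂ := fun t => iteratedDeriv 2 f (x + t)) (g₃ := fun t => iteratedDeriv 3 f (x + t))
    hs hε.1 (fun t ht => hf.pos _ (hpos t ht)) (hderiv fun y hy => hf.hasDerivAt hy)
    (hderiv fun y hy => hf.hasDerivAt_deriv hy)
    (hderiv fun y hy => hasDerivAt_iteratedDeriv (n := 3) hf.contDiffOn isOpen_Ioi
      (by norm_num) hy)
    (fun t ht => le_supShift hf.continuousOn hx (hmem t ht))
    (fun t ht => le_supShift hf.continuousOn_abs_deriv_pow_three hx (hmem t ht))
    (fun t ht => le_supShift hf.continuousOn_abs_deriv_mul_deriv_two hx (hmem t ht))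
    (fun t ht => le_supShift hf.continuousOn_abs_deriv_three hx (hmem t ht))
  simpa only [shiftGap, add_zero] using this

end ShiftGap

lemma TailCondition.integrableOn_inv_mul_deriv_sq {f : ℝ → ℝ} (hf : IsHalfLineDensity f)
    (ht : TailCondition f) {η : ℝ} (hη : 0 < η) :
    IntegrableOn (fun x => (f x)⁻¹ * deriv f x ^ 2) (Ioi η) := by
  obtain ⟨c, -, δ, -, hJ, -⟩ := ht
  exact integrableOn_Ioi_of_continuousOn hf.continuousOn_inv_mul_deriv_sq hJ hη

lemma exists_abs_integral_shiftGap_sub_le {f : ℝ → ℝ} (hf : IsHalfLineDensity f)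
    (ht : TailCondition f) {η : ℝ} (hη : 0 < η) :
    ∃ C δ : ℝ, 0 < δ ∧ ∀ ε ∈ Ioc 0 δ, ∀ s ∈ Ioo (0 : ℝ) 1,
      |(∫ x in Ioi η, shiftGap f ε s x) -
        s * (1 - s) / 2 * (∫ x in Ioi η, (f x)⁻¹ * deriv f x ^ 2) * ε ^ 2| ≤ C * ε ^ 3 := by
  have hJ := ht.integrableOn_inv_mul_deriv_sq hf hη
  obtain ⟨c, -, δ, hδ, -, h₁, h₂, h₃⟩ := ht
  have hext : ∀ {h : ℝ → ℝ}, ContinuousOn h (Ioi 0) →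
      IntegrableOn (fun x => supShift δ f x * supShift δ h x) (Ioi c) →
      IntegrableOn (fun x => supShift δ f x * supShift δ h x) (Ioi η) := fun hcont hint =>
    integrableOn_Ioi_of_continuousOn
      ((continuousOn_supShift hf.continuousOn δ).mul (continuousOn_supShift hcont δ)) hint hη
  obtain ⟨W, hW, hle⟩ : ∃ W : ℝ → ℝ, IntegrableOn W (Ioi η) ∧
      ∀ x ∈ Ioi η, ∀ ε ∈ Ioc 0 δ, ∀ s ∈ Ioo (0 : ℝ) 1,
        |shiftGap f ε s x - s * (1 - s) / 2 * ((f x)⁻¹ * deriv f x ^ 2) * ε ^ 2| ≤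
          W x * ε ^ 3 := by
    have hsum := ((hext hf.continuousOn_abs_deriv_pow_three h₁).add
      (hext hf.continuousOn_abs_deriv_mul_deriv_two h₂)).add
      (hext hf.continuousOn_abs_deriv_three h₃)
    simp only [Pi.add_def, ← mul_add] at hsum
    exact ⟨_, hsum, fun x hx ε hε s hs =>
      abs_shiftGap_sub_le hf hs (hη.trans hx) ⟨hε.1.le, hε.2⟩⟩
  refine ⟨∫ x in Ioi η, W x, δ, hδ, fun ε hε s hs => ?_⟩
  rw [← integral_const_mul, ← integral_mul_const, ← integral_mul_const,
    ← integral_sub (integrable_shiftGap hf ε hs).integrableOn ((hJ.const_mul _).mul_const _)]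
  rw [← Real.norm_eq_abs]
  refine norm_integral_le_of_norm_le (hW.mul_const (ε ^ 3)) ?_
  filter_upwards [ae_restrict_mem measurableSet_Ioi] with x hx
  exact hle x hx ε hε s hs

/-! ### Uniform limits of the deficit -/

/-- The filter `ε → +0` with `s` ranging freely over `(0, 1)`: convergence along it is
convergence uniform in `s`. -/
abbrev shiftFilter : Filter (ℝ × ℝ) := 𝓝[>] (0 : ℝ) ×ˢ 𝓟 (Ioo (0 : ℝ) 1)

lemma uniformLimit_iff_tendsto {R : ℝ → ℝ → ℝ} {L : ℝ → ℝ} :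
    UniformLimit R L ↔ Tendsto (fun q : ℝ × ℝ => R q.1 q.2 - L q.2) shiftFilter (𝓝 0) := by
  rw [UniformLimit, tendstoUniformlyOn_iff_tendsto, tendsto_uniformity_iff_dist_tendsto_zero]
  simp only [dist_comm (L _), Real.dist_eq]
  exact (tendsto_zero_iff_abs_tendsto_zero _).symm

lemma eventually_shiftFilter :
    ∀ᶠ q : ℝ × ℝ in shiftFilter, 0 < q.1 ∧ q.2 ∈ Ioo (0 : ℝ) 1 :=
  (tendsto_fst.eventually self_mem_nhdsWithin).and (tendsto_snd.eventually (mem_principal_self _))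

/-- The amount by which the affinity `∫ f (x + ε) ^ s * f x ^ (1 - s)` falls short of `1`. -/
noncomputable def deficit (f : ℝ → ℝ) (ε s : ℝ) : ℝ :=
  1 - ∫ x, f (x + ε) ^ s * f x ^ (1 - s)

lemma relRenyi_shift (f : ℝ → ℝ) (θ ε s : ℝ) :
    relRenyi s (shift f θ) (shift f (θ + ε)) = -Real.log (1 - deficit f ε s) := by
  rw [relRenyi, deficit, sub_sub_cancel, ← integral_add_right_eq_self _ (θ + ε)]
  have hshift (x : ℝ) : x + (θ + ε) - θ = x + ε := by ring
  simp only [shift, hshift, add_sub_cancel_right]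

section Deficit

variable {f : ℝ → ℝ} (hf : IsHalfLineDensity f) {ε s : ℝ} (hs : s ∈ Ioo (0 : ℝ) 1)
include hf

lemma deficit_le_one : deficit f ε s ≤ 1 :=
  sub_le_self _ <| integral_nonneg fun _ =>
    mul_nonneg (Real.rpow_nonneg (hf.nonneg _) _) (Real.rpow_nonneg (hf.nonneg _) _)

lemma integral_Iic_comp_add_right (ε : ℝ) :
    ∫ x in Iic 0, f (x + ε) = ∫ x in Ioc 0 ε, f x := by
  have htrans : ∫ x in Iic 0, f (x + ε) = ∫ x in Iic ε, f x := by
    simpa using (measurePreserving_add_right volume ε).setIntegral_preimage_emb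
      (measurableEmbedding_addRight ε) f (Iic ε)
  rw [htrans, ← integral_Icc_eq_integral_Ioc]
  refine setIntegral_eq_of_subset_of_forall_sdiff_eq_zero measurableSet_Iic Icc_subset_Iic_self
    fun x hx => hf.eq_zero x (not_le.1 fun h0 => hx.2 ⟨h0, hx.1⟩)

include hs

lemma deficit_eq_integral_shiftGap : deficit f ε s = ∫ x, shiftGap f ε s x := by
  have hshift := hf.integrable.comp_add_right ε
  have hgeom := integrable_geom_mean hs hshift hf.integrable (fun _ => hf.nonneg _) hf.nonneg
  have hmean : Integrable fun x => s * f (x + ε) + (1 - s) * f x :=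
    (hshift.const_mul s).add (hf.integrable.const_mul _)
  calc deficit f ε s = (s * (∫ x, f (x + ε)) + (1 - s) * ∫ x, f x) -
        ∫ x, f (x + ε) ^ s * f x ^ (1 - s) := by
        rw [integral_add_right_eq_self, hf.integral_eq_one, deficit]; ring
    _ = ∫ x, shiftGap f ε s x := by
        rw [← integral_const_mul, ← integral_const_mul,
          ← integral_add (hshift.const_mul s) (hf.integrable.const_mul _),
          ← integral_sub hmean hgeom]
        rfl

lemma deficit_nonneg : 0 ≤ deficit f ε s := by
  rw [deficit_eq_integral_shiftGap hf hs]
  exact integral_nonneg fun _ => shiftGap_nonneg hf hs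

lemma deficit_eq_add (ε : ℝ) {η : ℝ} (hη : 0 < η) :
    deficit f ε s = s * (∫ x in Ioc 0 ε, f x) +
      ((∫ x in Ioc 0 η, shiftGap f ε s x) + ∫ x in Ioi η, shiftGap f ε s x) := by
  have hgap := integrable_shiftGap hf ε hs
  have hleft : ∫ x in Iic 0, shiftGap f ε s x = s * ∫ x in Ioc 0 ε, f x := by
    rw [← integral_Iic_comp_add_right hf ε, ← integral_const_mul, integral_Iic_eq_integral_Iio,
      integral_Iic_eq_integral_Iio]
    refine setIntegral_congr_fun measurableSet_Iio fun x hx => ?_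
    simp [shiftGap, meanGap, hf.eq_zero x hx, Real.zero_rpow (sub_pos.2 hs.2).ne']
  rw [deficit_eq_integral_shiftGap hf hs, ← intervalIntegral.integral_Iic_add_Ioi (b := 0)
    hgap.integrableOn hgap.integrableOn, hleft, ← Ioc_union_Ioi_eq_Ioi hη.le,
    setIntegral_union Ioc_disjoint_Ioi_same measurableSet_Ioi hgap.integrableOn hgap.integrableOn]

end Deficit

lemma exists_abs_le_of_tendsto_deficit {f : ℝ → ℝ} (hf : IsHalfLineDensity f) {φ L : ℝ → ℝ}
    (h : Tendsto (fun q : ℝ × ℝ => deficit f q.1 q.2 / φ q.1 - L q.2) shiftFilter (𝓝 0)) :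
    ∃ M, ∀ s ∈ Ioo (0 : ℝ) 1, |L s| ≤ M := by
  have hball := h.eventually (Metric.ball_mem_nhds 0 one_pos)
  rw [eventually_prod_principal_iff] at hball
  obtain ⟨ε, hε⟩ := hball.exists
  refine ⟨1 + |(φ ε)⁻¹|, fun s hs => ?_⟩
  have hclose : |deficit f ε s / φ ε - L s| ≤ 1 := by simpa using (hε s hs).le
  have hdeficit : |deficit f ε s / φ ε| ≤ |(φ ε)⁻¹| := by
    rw [div_eq_mul_inv, abs_mul, abs_of_nonneg (deficit_nonneg hf hs)]
    exact mul_le_of_le_one_left (abs_nonneg _) (deficit_le_one hf)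
  have htri := abs_sub (deficit f ε s / φ ε) (deficit f ε s / φ ε - L s)
  rw [sub_sub_cancel] at htri
  linarith

lemma neg_log_one_sub_sub_isLittleO :
    (fun u : ℝ => -Real.log (1 - u) - u) =o[𝓝 0] fun u => u := by
  have hderiv : HasDerivAt (fun u : ℝ => -Real.log (1 - u)) 1 0 := by
    simpa using (((hasDerivAt_id (0 : ℝ)).const_sub 1).log (by simp)).fun_neg
  simpa using hderiv.isLittleO

lemma uniformLimit_relRenyi {f : ℝ → ℝ} (hf : IsHalfLineDensity f) {φ L : ℝ → ℝ}
    (hφ : ∀ᶠ ε in 𝓝[>] (0 : ℝ), 0 < φ ε) (hφ0 : Tendsto φ (𝓝[>] 0) (𝓝 0))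
    (h : Tendsto (fun q : ℝ × ℝ => deficit f q.1 q.2 / φ q.1 - L q.2) shiftFilter (𝓝 0)) (θ : ℝ) :
    UniformLimit (fun ε s => relRenyi s (shift f θ) (shift f (θ + ε)) / φ ε) L := by
  obtain ⟨M, hM⟩ := exists_abs_le_of_tendsto_deficit hf h
  have hL : (fun q : ℝ × ℝ => L q.2) =O[shiftFilter] fun _ => (1 : ℝ) :=
    .of_bound M <| eventually_shiftFilter.mono fun q hq => by simpa using hM q.2 hq.2
  have hratio : (fun q : ℝ × ℝ => deficit f q.1 q.2 / φ q.1) =O[shiftFilter] fun _ => (1 : ℝ) := by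
    simpa using (h.isBigO_one ℝ).add hL
  have hO : (fun q : ℝ × ℝ => deficit f q.1 q.2) =O[shiftFilter] fun q => φ q.1 := by
    refine (hratio.mul (isBigO_refl (fun q : ℝ × ℝ => φ q.1) _)).congr' ?_ (by simp)
    filter_upwards [tendsto_fst.eventually hφ] with q hq using div_mul_cancel₀ _ hq.ne'
  have hlog : (fun q : ℝ × ℝ => -Real.log (1 - deficit f q.1 q.2) - deficit f q.1 q.2)
      =o[shiftFilter] fun q => φ q.1 :=
    (neg_log_one_sub_sub_isLittleO.comp_tendsto
      (hO.trans_tendsto (hφ0.comp tendsto_fst))).trans_isBigO hO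
  rw [uniformLimit_iff_tendsto]
  simpa [relRenyi_shift, sub_div] using hlog.tendsto_div_nhds_zero.add h

section Localization

variable {f : ℝ → ℝ} (hf : IsHalfLineDensity f) (ht : TailCondition f) {φ : ℝ → ℝ} {c : ℝ}
  (hsq : Tendsto (fun ε => ε ^ 2 / φ ε) (𝓝[>] 0) (𝓝 c))
include hf ht hsq

lemma tendsto_integral_Ioi_shiftGap_div {η : ℝ} (hη : 0 < η) :
    Tendsto (fun q : ℝ × ℝ => (∫ x in Ioi η, shiftGap f q.1 q.2 x) / φ q.1 -
      c * (q.2 * (1 - q.2) / 2 * ∫ x in Ioi η, (f x)⁻¹ * deriv f x ^ 2)) shiftFilter (𝓝 0) := by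
  obtain ⟨C, δ, hδ, hbound⟩ := exists_abs_integral_shiftGap_sub_le hf ht hη
  set J := ∫ x in Ioi η, (f x)⁻¹ * deriv f x ^ 2
  have hmajorant : Tendsto (fun ε : ℝ => |C| * ε * |ε ^ 2 / φ ε| + |J| * |ε ^ 2 / φ ε - c|)
      (𝓝[>] 0) (𝓝 0) := by
    have hid : Tendsto (fun ε : ℝ => ε) (𝓝[>] 0) (𝓝 0) := nhdsWithin_le_nhds
    simpa using ((hid.const_mul |C|).mul hsq.abs).add ((hsq.sub_const c).abs.const_mul |J|)
  refine squeeze_zero_norm' ?_ (hmajorant.comp tendsto_fst)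
  have hsmall : ∀ᶠ ε : ℝ in 𝓝[>] 0, ε ∈ Ioc 0 δ := Ioc_mem_nhdsGT hδ
  filter_upwards [eventually_shiftFilter, tendsto_fst.eventually hsmall] with ⟨ε, s⟩ ⟨hε, hs⟩ hεδ
  dsimp only [Function.comp_apply] at hε hs hεδ ⊢
  set I := ∫ x in Ioi η, shiftGap f ε s x
  have hremainder : |(I - s * (1 - s) / 2 * J * ε ^ 2) / φ ε| ≤ |C| * ε * |ε ^ 2 / φ ε| := by
    rw [abs_div, abs_div, abs_of_nonneg (sq_nonneg ε), ← mul_div_assoc]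
    gcongr
    nlinarith [hbound ε hεδ s hs, mul_le_mul_of_nonneg_right (le_abs_self C) (pow_pos hε 3).le]
  have hweight : |s * (1 - s) / 2| ≤ 1 := by
    rw [abs_of_nonneg (by nlinarith [hs.1, hs.2])]
    nlinarith [hs.1, hs.2]
  have hlimit : |s * (1 - s) / 2 * J * (ε ^ 2 / φ ε - c)| ≤ |J| * |ε ^ 2 / φ ε - c| := by
    rw [abs_mul, abs_mul]
    gcongr
    exact mul_le_of_le_one_left (abs_nonneg _) hweight
  calc ‖I / φ ε - c * (s * (1 - s) / 2 * J)‖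
      = |(I - s * (1 - s) / 2 * J * ε ^ 2) / φ ε + s * (1 - s) / 2 * J * (ε ^ 2 / φ ε - c)| := by
        rw [Real.norm_eq_abs]; ring_nf
    _ ≤ _ := (abs_add_le _ _).trans (add_le_add hremainder hlimit)

lemma tendsto_deficit_div_of_near {L : ℝ → ℝ} {m : ℝ}
    (hmass : Tendsto (fun ε => (∫ x in Ioc 0 ε, f x) / φ ε) (𝓝[>] 0) (𝓝 m))
    (hnear : ∀ τ > 0, ∃ η > 0, ∀ᶠ q : ℝ × ℝ in shiftFilter,
      |(∫ x in Ioc 0 η, shiftGap f q.1 q.2 x) / φ q.1 - (L q.2 - q.2 * m -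
        c * (q.2 * (1 - q.2) / 2 * ∫ x in Ioi η, (f x)⁻¹ * deriv f x ^ 2))| ≤ τ) :
    Tendsto (fun q : ℝ × ℝ => deficit f q.1 q.2 / φ q.1 - L q.2) shiftFilter (𝓝 0) := by
  rw [Metric.tendsto_nhds]
  intro τ hτ
  obtain ⟨η, hη, hnear⟩ := hnear (τ / 3) (by positivity)
  have htail := (tendsto_integral_Ioi_shiftGap_div hf ht hsq hη).eventually
    (Metric.ball_mem_nhds 0 (by positivity : 0 < τ / 3))
  have hmass := hmass.eventually (Metric.ball_mem_nhds m (by positivity : 0 < τ / 3))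
  filter_upwards [eventually_shiftFilter, tendsto_fst.eventually hmass, hnear, htail]
    with ⟨ε, s⟩ ⟨_, hs⟩ hmass hnear htail
  dsimp only at hs hmass hnear htail ⊢
  rw [Real.dist_eq] at hmass htail
  rw [sub_zero] at htail
  rw [Real.dist_eq, sub_zero, deficit_eq_add hf hs ε hη]
  set F := ∫ x in Ioc 0 ε, f x
  set N := ∫ x in Ioc 0 η, shiftGap f ε s x
  set T := ∫ x in Ioi η, shiftGap f ε s x
  set J := ∫ x in Ioi η, (f x)⁻¹ * deriv f x ^ 2
  have hmass' : |s * (F / φ ε - m)| < τ / 3 := by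
    rw [abs_mul, abs_of_pos hs.1]
    exact (mul_le_of_le_one_left (abs_nonneg _) hs.2.le).trans_lt hmass
  calc |(s * F + (N + T)) / φ ε - L s|
      = |s * (F / φ ε - m) + (N / φ ε - (L s - s * m - c * (s * (1 - s) / 2 * J))) +
          (T / φ ε - c * (s * (1 - s) / 2 * J))| := by ring_nf
    _ ≤ _ := abs_add_three _ _ _
    _ < τ := by linarith

end Localization

/-! ### Functions of the size of a power -/

section PowerLike

lemma rpow_le_two_rpow_abs_mul {p x z : ℝ} (hx : 0 < x) (hxz : x ≤ z) (hz : z ≤ 2 * x) :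
    z ^ p ≤ 2 ^ |p| * x ^ p := by
  have hz0 := hx.trans_le hxz
  have hratio : (z / x) ^ p ≤ 2 ^ |p| :=
    calc (z / x) ^ p ≤ (z / x) ^ |p| :=
          Real.rpow_le_rpow_of_exponent_le ((one_le_div hx).2 hxz) (le_abs_self p)
      _ ≤ 2 ^ |p| := by gcongr; exact (div_le_iff₀ hx).2 hz
  rwa [Real.div_rpow hz0.le hx.le, div_le_iff₀ (by positivity)] at hratio

lemma rpow_le_two_rpow_abs_mul_rpow {p x z : ℝ} (hx : 0 < x) (hxz : x ≤ z) (hz : z ≤ 2 * x) :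
    x ^ p ≤ 2 ^ |p| * z ^ p := by
  have hz0 := hx.trans_le hxz
  have hneg := rpow_le_two_rpow_abs_mul (p := -p) hx hxz hz
  rw [abs_neg, Real.rpow_neg hz0.le, Real.rpow_neg hx.le, ← div_eq_mul_inv,
    inv_le_comm₀ (by positivity) (by positivity), inv_div] at hneg
  exact (div_le_iff₀' (by positivity)).1 hneg

/-- On the set `S`, the function `f` lies between constant multiples of `x ^ p` and its derivative
is at most of the order of `x ^ (p - 1)`. -/
structure IsPowerLikeOn (f : ℝ → ℝ) (S : Set ℝ) (p c C : ℝ) : Prop where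
  le_apply : ∀ x ∈ S, c * x ^ p ≤ f x
  apply_le : ∀ x ∈ S, f x ≤ C * x ^ p
  differentiableAt : ∀ x ∈ S, DifferentiableAt ℝ f x
  abs_deriv_le : ∀ x ∈ S, |deriv f x| ≤ C * x ^ (p - 1)

lemma isPowerLikeOn_rpow (p : ℝ) : IsPowerLikeOn (· ^ p) (Ioi 0) p 1 (1 + |p|) where
  le_apply x _ := (one_mul _).le
  apply_le x (hx : 0 < x) := le_mul_of_one_le_left (by positivity) (by simp)
  differentiableAt x (hx : 0 < x) := Real.differentiableAt_rpow_const_of_ne p hx.ne'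
  abs_deriv_le x (hx : 0 < x) := by
    rw [Real.deriv_rpow_const, abs_mul, abs_of_pos (by positivity : 0 < x ^ (p - 1))]
    gcongr
    linarith

/-- Up to a constant factor, a majorant of `shiftGap (· ^ p) 1 s y` uniform in `s`. -/
noncomputable def scaleBound (p y : ℝ) : ℝ :=
  if y ≤ 1 then y ^ p + (y + 1) ^ p else y ^ (p - 2)

lemma scaleBound_nonneg {p y : ℝ} (hy : 0 ≤ y) : 0 ≤ scaleBound p y := by
  unfold scaleBound; split_ifs <;> positivity

namespace IsPowerLikeOn

variable {f : ℝ → ℝ} {S : Set ℝ} {p c C : ℝ} (hf : IsPowerLikeOn f S p c C) (hc : 0 < c)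
include hf hc

lemma inv_mul_deriv_sq_le {x : ℝ} (hx : 0 < x) (hxS : x ∈ S) :
    (f x)⁻¹ * deriv f x ^ 2 ≤ C ^ 2 / c * x ^ (p - 2) := by
  have hpow : x ^ (p - 1) = x ^ p / x := by rw [Real.rpow_sub hx, Real.rpow_one]
  have hpow' : x ^ (p - 2) = x ^ p / x ^ 2 := by rw [Real.rpow_sub hx, Real.rpow_two]
  calc (f x)⁻¹ * deriv f x ^ 2 ≤ (c * x ^ p)⁻¹ * (C * x ^ (p - 1)) ^ 2 := by
        rw [← sq_abs (deriv f x)]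
        gcongr
        exacts [hf.le_apply x hxS, hf.abs_deriv_le x hxS]
    _ = C ^ 2 / c * x ^ (p - 2) := by rw [hpow, hpow']; field_simp

lemma exists_shiftGap_le_rpow_mul_sq :
    ∃ D, 0 ≤ D ∧ ∀ s ∈ Ioo (0 : ℝ) 1, ∀ x ε : ℝ, 0 < ε → ε ≤ x → Icc x (x + ε) ⊆ S →
      shiftGap f ε s x ≤ D * (x ^ (p - 2) * ε ^ 2) := by
  refine ⟨(C * 2 ^ |p - 1|) ^ 2 / (c / 2 ^ |p|), by positivity, fun s hs x ε hε hεx hS => ?_⟩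
  have hx : 0 < x := hε.trans_le hεx
  have hleft : x ∈ Icc x (x + ε) := left_mem_Icc.2 (by linarith)
  have hright : x + ε ∈ Icc x (x + ε) := right_mem_Icc.2 (by linarith)
  have hC : 0 ≤ C := nonneg_of_mul_nonneg_left
    ((abs_nonneg _).trans (hf.abs_deriv_le x (hS hleft))) (by positivity)
  have hlower : ∀ z ∈ Icc x (x + ε), c / 2 ^ |p| * x ^ p ≤ f z := fun z hz => by
    refine le_trans ?_ (hf.le_apply z (hS hz))
    rw [div_mul_eq_mul_div, div_le_iff₀ (by positivity), mul_assoc, mul_comm (z ^ p)]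
    gcongr
    exact rpow_le_two_rpow_abs_mul_rpow hx hz.1 (by linarith [hz.2])
  have hderiv : ∀ z ∈ Icc x (x + ε), ‖deriv f z‖ ≤ C * 2 ^ |p - 1| * x ^ (p - 1) := fun z hz => by
    refine (hf.abs_deriv_le z (hS hz)).trans ?_
    rw [mul_assoc]
    gcongr
    exact rpow_le_two_rpow_abs_mul hx hz.1 (by linarith [hz.2])
  have hdiff : |f (x + ε) - f x| ≤ C * 2 ^ |p - 1| * x ^ (p - 1) * ε := by
    simpa [abs_of_pos hε] using (convex_Icc x (x + ε)).norm_image_sub_le_of_norm_deriv_le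
      (fun z hz => hf.differentiableAt z (hS hz)) hderiv hleft hright
  have hpow : x ^ (p - 1) = x ^ p / x := by rw [Real.rpow_sub hx, Real.rpow_one]
  have hpow' : x ^ (p - 2) = x ^ p / x ^ 2 := by rw [Real.rpow_sub hx, Real.rpow_two]
  calc shiftGap f ε s x ≤ (f (x + ε) - f x) ^ 2 / (c / 2 ^ |p| * x ^ p) :=
        meanGap_le_sq_div_of_le hs (by positivity) (hlower _ hright) (hlower _ hleft)
    _ ≤ (C * 2 ^ |p - 1| * x ^ (p - 1) * ε) ^ 2 / (c / 2 ^ |p| * x ^ p) := by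
        rw [← sq_abs (f (x + ε) - f x)]
        gcongr
    _ = (C * 2 ^ |p - 1|) ^ 2 / (c / 2 ^ |p|) * (x ^ (p - 2) * ε ^ 2) := by
        rw [hpow, hpow']; field_simp

lemma exists_shiftGap_le_scaleBound :
    ∃ K, 0 ≤ K ∧ ∀ s ∈ Ioo (0 : ℝ) 1, ∀ x ε : ℝ, 0 < x → 0 < ε → Icc x (x + ε) ⊆ S →
      shiftGap f ε s x ≤ K * (ε ^ p * scaleBound p (x / ε)) := by
  obtain ⟨D, hD, hgap⟩ := hf.exists_shiftGap_le_rpow_mul_sq hc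
  refine ⟨max C D, le_max_of_le_right hD, fun s hs x ε hx hε hS => ?_⟩
  have hxε : 0 < x / ε := by positivity
  unfold scaleBound
  split_ifs with hle
  · have hxS := hS (left_mem_Icc.2 (by linarith))
    have hyS := hS (right_mem_Icc.2 (by linarith))
    have hpos : ∀ z ∈ S, 0 < z → 0 ≤ f z := fun z hz _ =>
      le_trans (by positivity) (hf.le_apply z hz)
    have hscale : ε ^ p * ((x / ε) ^ p + (x / ε + 1) ^ p) = x ^ p + (x + ε) ^ p := by
      rw [mul_add, ← Real.mul_rpow hε.le hxε.le, ← Real.mul_rpow hε.le (by positivity), mul_add,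
        mul_div_cancel₀ x hε.ne', mul_one]
    calc shiftGap f ε s x ≤ f (x + ε) + f x :=
          meanGap_le_add hs (hpos _ hyS (by positivity)) (hpos _ hxS hx)
      _ ≤ C * (x + ε) ^ p + C * x ^ p := add_le_add (hf.apply_le _ hyS) (hf.apply_le _ hxS)
      _ = C * (x ^ p + (x + ε) ^ p) := by ring
      _ ≤ max C D * (x ^ p + (x + ε) ^ p) := by gcongr; exact le_max_left _ _
      _ = _ := by rw [hscale]
  · have hscale : ε ^ p * (x / ε) ^ (p - 2) = x ^ (p - 2) * ε ^ 2 := by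
      rw [Real.div_rpow hx.le hε.le, Real.rpow_sub hε, Real.rpow_two]
      field_simp
    rw [not_le, one_lt_div hε] at hle
    calc shiftGap f ε s x ≤ D * (x ^ (p - 2) * ε ^ 2) := hgap s hs x ε hε hle.le hS
      _ ≤ max C D * (x ^ (p - 2) * ε ^ 2) := by gcongr; exact le_max_right _ _
      _ = _ := by rw [hscale]

end IsPowerLikeOn

lemma integrableOn_Ioc_rpow {p : ℝ} (hp : -1 < p) {η : ℝ} (hη : 0 ≤ η) :
    IntegrableOn (fun x : ℝ => x ^ p) (Ioc 0 η) :=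
  (intervalIntegrable_iff_integrableOn_Ioc_of_le hη).1
    (intervalIntegral.intervalIntegrable_rpow' hp)

lemma integrableOn_scaleBound {p : ℝ} (hp : p ∈ Ioo (-1 : ℝ) 1) :
    IntegrableOn (scaleBound p) (Ioi 0) := by
  rw [← Ioc_union_Ioi_eq_Ioi zero_le_one]
  refine IntegrableOn.union ?_ ?_
  · have hcont : ContinuousOn (fun y : ℝ => (y + 1) ^ p) (Icc 0 1) :=
      ContinuousOn.rpow_const (by fun_prop) fun x hx => .inl (by linarith [hx.1])
    exact ((integrableOn_Ioc_rpow hp.1 zero_le_one).add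
      (hcont.integrableOn_Icc.mono_set Ioc_subset_Icc_self)).congr_fun
      (fun y hy => (if_pos hy.2).symm) measurableSet_Ioc
  · exact (integrableOn_Ioi_rpow_of_lt (by linarith [hp.2]) one_pos).congr_fun
      (fun y hy => (if_neg (not_le.2 hy)).symm) measurableSet_Ioi

end PowerLike

/-! ### The endpoint -/

lemma tendsto_rpow_nhdsGT_zero {p : ℝ} (hp : 0 < p) :
    Tendsto (fun x : ℝ => x ^ p) (𝓝[>] 0) (𝓝 0) := by
  simpa [Real.zero_rpow hp.ne'] using
    (Real.continuousAt_rpow_const 0 p (.inr hp.le)).tendsto.mono_left nhdsWithin_le_nhds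

lemma tendsto_const_mul_nhdsGT_zero {c : ℝ} (hc : 0 < c) :
    Tendsto (fun x : ℝ => c * x) (𝓝[>] 0) (𝓝[>] 0) :=
  tendsto_iff_comap.2 (comap_mulLeft_nhdsGT_zero hc).ge

/-- The endpoint behaviour with exponent `κ - 1` on which the first-order asymptotics depend: no
second derivative enters, and `f'` needs a limit only at `κ = 2`. -/
structure FirstOrderEndpoint (f : ℝ → ℝ) (A κ : ℝ) : Prop where
  A_pos : 0 < A
  kappa_pos : 0 < κ
  equiv : f ~[𝓝[>] 0] fun x => A * x ^ (κ - 1)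
  deriv_isBigO : deriv f =O[𝓝[>] 0] fun x => x ^ (κ - 2)
  tendsto_deriv_of_two : κ = 2 → Tendsto (deriv f) (𝓝[>] 0) (𝓝 A)

lemma EndpointCondition.firstOrder {f : ℝ → ℝ} {A κ : ℝ} (h : EndpointCondition f A κ) :
    FirstOrderEndpoint f A κ where
  A_pos := h.A_pos
  kappa_pos := h.kappa_pos
  equiv := h.equiv
  deriv_isBigO := by
    rcases ne_or_eq κ 1 with hκ | rfl
    · exact (h.equiv_deriv hκ).isBigO.trans ((isBigO_refl _ _).const_mul_left _)
    · obtain ⟨l, hl⟩ := h.limit_deriv_of_one rfl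
      refine (hl.isBigO_one ℝ).trans (.of_bound 1 ?_)
      filter_upwards [Ioc_mem_nhdsGT (zero_lt_one' ℝ)] with x hx
      rw [norm_one, one_mul, Real.norm_of_nonneg (Real.rpow_nonneg hx.1.le _)]
      exact Real.one_le_rpow_of_pos_of_le_one_of_nonpos hx.1 hx.2 (by norm_num)
  tendsto_deriv_of_two := by
    rintro rfl
    have hlim := h.equiv_deriv (by norm_num)
    norm_num at hlim
    exact (isEquivalent_const_iff_tendsto h.A_pos.ne').1 hlim

lemma tendsto_integral_Ioc_div_rpow {f : ℝ → ℝ} {A κ : ℝ} (hκ : 0 < κ) (hf : Integrable f)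
    (hcont : ContinuousOn f (Ioi 0))
    (hlim : Tendsto (fun x => f x / x ^ (κ - 1)) (𝓝[>] 0) (𝓝 A)) :
    Tendsto (fun ε => (∫ x in Ioc 0 ε, f x) / ε ^ κ) (𝓝[>] 0) (𝓝 (A / κ)) := by
  have hprimitive : ∀ᶠ ε in 𝓝[>] (0 : ℝ), HasDerivAt (fun ε => ∫ x in (0)..ε, f x) (f ε) ε := by
    filter_upwards [self_mem_nhdsWithin] with ε hε
    exact intervalIntegral.integral_hasDerivAt_right hf.intervalIntegrable
      (hcont.stronglyMeasurableAtFilter isOpen_Ioi ε hε) (hcont.continuousAt (Ioi_mem_nhds hε))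
  have hpow : ∀ᶠ ε in 𝓝[>] (0 : ℝ), HasDerivAt (fun ε => ε ^ κ) (κ * ε ^ (κ - 1)) ε := by
    filter_upwards [self_mem_nhdsWithin] with ε hε using
      Real.hasDerivAt_rpow_const (.inl (ne_of_gt hε))
  have hpow_ne : ∀ᶠ ε in 𝓝[>] (0 : ℝ), κ * ε ^ (κ - 1) ≠ 0 := by
    filter_upwards [self_mem_nhdsWithin] with ε (hε : 0 < ε) using by positivity
  have hprimitive0 : Tendsto (fun ε => ∫ x in (0)..ε, f x) (𝓝[>] 0) (𝓝 0) := by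
    simpa using (intervalIntegral.continuous_primitive (fun _ _ => hf.intervalIntegrable) 0
      |>.tendsto 0).mono_left nhdsWithin_le_nhds
  refine (HasDerivAt.lhopital_zero_nhdsGT hprimitive hpow hpow_ne hprimitive0
    (tendsto_rpow_nhdsGT_zero hκ) ?_).congr' ?_
  · exact (hlim.div_const κ).congr fun x => by rw [div_div, mul_comm]
  · filter_upwards [self_mem_nhdsWithin] with ε hε
    rw [intervalIntegral.integral_of_le (le_of_lt hε)]

namespace FirstOrderEndpoint

variable {f : ℝ → ℝ} {A κ : ℝ} (h : FirstOrderEndpoint f A κ)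
include h

lemma tendsto_div_rpow : Tendsto (fun x => f x / x ^ (κ - 1)) (𝓝[>] 0) (𝓝 A) := by
  refine (isEquivalent_const_iff_tendsto h.A_pos.ne').1
    ((h.equiv.div (IsEquivalent.refl (u := fun x : ℝ => x ^ (κ - 1)))).congr_right ?_)
  filter_upwards [self_mem_nhdsWithin] with x (hx : 0 < x)
  exact mul_div_cancel_right₀ A (by positivity)

lemma tendsto_integral_Ioc_div (hf : IsHalfLineDensity f) :
    Tendsto (fun ε => (∫ x in Ioc 0 ε, f x) / ε ^ κ) (𝓝[>] 0) (𝓝 (A / κ)) :=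
  tendsto_integral_Ioc_div_rpow h.kappa_pos hf.integrable hf.continuousOn h.tendsto_div_rpow

lemma exists_isPowerLikeOn (hf : IsHalfLineDensity f) :
    ∃ R > 0, ∃ c > 0, ∃ C, IsPowerLikeOn f (Ioo 0 R) (κ - 1) c C := by
  obtain ⟨C, hC⟩ := h.deriv_isBigO.bound
  have hratio : ∀ᶠ x in 𝓝[>] 0, f x / x ^ (κ - 1) ∈ Icc (A / 2) (2 * A) :=
    h.tendsto_div_rpow.eventually (Icc_mem_nhds (by linarith [h.A_pos]) (by linarith [h.A_pos]))
  obtain ⟨R, hR, hbound⟩ := mem_nhdsGT_iff_exists_Ioo_subset.1 (hratio.and hC)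
  refine ⟨R, hR, A / 2, half_pos h.A_pos, max (2 * A) C, fun x hx => ?_, fun x hx => ?_,
    fun x hx => (hf.hasDerivAt hx.1).differentiableAt, fun x hx => ?_⟩
  all_goals
    have hx0 : 0 < x := hx.1
    obtain ⟨hratio, hderiv⟩ := hbound hx
  · exact (le_div_iff₀ (by positivity)).1 hratio.1
  · refine ((div_le_iff₀ (by positivity)).1 hratio.2).trans ?_
    gcongr
    exact le_max_left _ _
  · rw [sub_sub, one_add_one_eq_two]
    rw [Real.norm_eq_abs, Real.norm_of_nonneg (by positivity)] at hderiv
    refine hderiv.trans ?_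
    gcongr
    exact le_max_right _ _

end FirstOrderEndpoint

/-! ### The beta integral -/

section Beta

lemma exists_shiftGap_rpow_le (p : ℝ) :
    ∃ K, 0 ≤ K ∧ ∀ s ∈ Ioo (0 : ℝ) 1, ∀ y > 0, shiftGap (· ^ p) 1 s y ≤ K * scaleBound p y := by
  obtain ⟨K, hK, hgap⟩ := (isPowerLikeOn_rpow p).exists_shiftGap_le_scaleBound one_pos
  refine ⟨K, hK, fun s hs y hy => ?_⟩
  simpa using hgap s hs y 1 hy one_pos fun z hz => hy.trans_le hz.1

lemma integrableOn_shiftGap_rpow {p s : ℝ} (hp : p ∈ Ioo (-1 : ℝ) 1) (hs : s ∈ Ioo (0 : ℝ) 1) :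
    IntegrableOn (shiftGap (· ^ p) 1 s) (Ioi 0) := by
  obtain ⟨K, -, hgap⟩ := exists_shiftGap_rpow_le p
  refine ((integrableOn_scaleBound hp).const_mul K).mono' ?_ ?_
  · unfold shiftGap meanGap
    fun_prop
  · filter_upwards [ae_restrict_mem measurableSet_Ioi] with y (hy : 0 < y)
    have hnonneg : 0 ≤ shiftGap (· ^ p) 1 s y :=
      meanGap_nonneg hs (by positivity) (by positivity)
    rw [Real.norm_of_nonneg hnonneg]
    exact hgap s hs y hy

variable {a b : ℝ} (ha : 0 < a) (hb : 0 < b)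
include ha hb

lemma integral_Ioo_eq_beta :
    ∫ x in Ioo (0 : ℝ) 1, x ^ (a - 1) * (1 - x) ^ (b - 1) = ProbabilityTheory.beta a b := by
  have hconv := Complex.betaIntegral_convergent (u := a) (v := b) (by simpa) (by simpa)
  rw [intervalIntegrable_iff_integrableOn_Ioc_of_le zero_le_one] at hconv
  rw [ProbabilityTheory.beta_eq_betaIntegralReal a b ha hb, Complex.betaIntegral,
    intervalIntegral.integral_of_le zero_le_one, ← integral_Ioc_eq_integral_Ioo,
    ← RCLike.re_to_complex, ← integral_re hconv]
  refine setIntegral_congr_fun measurableSet_Ioc fun x hx => ?_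
  norm_cast
  rw [← Complex.ofReal_cpow hx.1.le, ← Complex.ofReal_cpow (by linarith [hx.2]),
    RCLike.re_to_complex, Complex.re_mul_ofReal, Complex.ofReal_re]

omit ha hb in
lemma image_div_one_sub_Ioo : (fun t : ℝ => t / (1 - t)) '' Ioo 0 1 = Ioi 0 := by
  refine Subset.antisymm (image_subset_iff.2 fun t ht => div_pos ht.1 (sub_pos.2 ht.2))
    fun y (hy : 0 < y) => ⟨y / (1 + y), ⟨by positivity, ?_⟩, ?_⟩
  · exact (div_lt_one (by positivity)).2 (by linarith)
  · field_simp
    ring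

lemma integral_Ioi_eq_beta :
    ∫ y in Ioi (0 : ℝ), y ^ (a - 1) * (1 + y) ^ (-(a + b)) = ProbabilityTheory.beta a b := by
  have hderiv : ∀ t ∈ Ioo (0 : ℝ) 1,
      HasDerivWithinAt (fun t : ℝ => t / (1 - t)) ((1 - t) ^ 2)⁻¹ (Ioo 0 1) t := fun t ht => by
    have hne : 1 - t ≠ 0 := (sub_pos.2 ht.2).ne'
    convert! ((hasDerivAt_id t).div ((hasDerivAt_id t).const_sub 1) hne).hasDerivWithinAt using 1
    simp only [id]
    field_simp
    ring
  have hinj : InjOn (fun t : ℝ => t / (1 - t)) (Ioo 0 1) := fun t ht u hu h => by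
    have heq := (div_eq_div_iff (sub_pos.2 ht.2).ne' (sub_pos.2 hu.2).ne').1 h
    linarith
  rw [← integral_Ioo_eq_beta ha hb, ← image_div_one_sub_Ioo,
    integral_image_eq_integral_abs_deriv_smul measurableSet_Ioo hderiv hinj]
  refine setIntegral_congr_fun measurableSet_Ioo fun t ht => ?_
  have ht1 : 0 < 1 - t := sub_pos.2 ht.2
  have hone : 1 + t / (1 - t) = (1 - t)⁻¹ := by field_simp; ring
  have hsq : ((1 - t) ^ 2)⁻¹ = (1 - t) ^ (-2 : ℝ) := by rw [Real.rpow_neg ht1.le, Real.rpow_two]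
  simp only [smul_eq_mul]
  rw [hone, abs_of_pos (by positivity), hsq, Real.div_rpow ht.1.le ht1.le,
    Real.inv_rpow ht1.le, Real.rpow_neg ht1.le (a + b), inv_inv, div_eq_mul_inv,
    ← Real.rpow_neg ht1.le]
  calc (1 - t) ^ (-2 : ℝ) * (t ^ (a - 1) * (1 - t) ^ (-(a - 1)) * (1 - t) ^ (a + b))
      = t ^ (a - 1) * ((1 - t) ^ (-2 : ℝ) * (1 - t) ^ (-(a - 1)) * (1 - t) ^ (a + b)) := by ring
    _ = t ^ (a - 1) * (1 - t) ^ (b - 1) := by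
      rw [← Real.rpow_add ht1, ← Real.rpow_add ht1]
      ring_nf

lemma integrableOn_Ioi_beta :
    IntegrableOn (fun y : ℝ => y ^ (a - 1) * (1 + y) ^ (-(a + b))) (Ioi 0) := by
  refine not_imp_comm.1 integral_undef ?_
  rw [integral_Ioi_eq_beta ha hb]
  exact (ProbabilityTheory.beta_pos ha hb).ne'

end Beta

section GapIntegral

lemma one_add_rpow_sub_isBigO (p : ℝ) :
    (fun t : ℝ => (1 + t) ^ p - 1 - p * t) =O[𝓝 0] fun t => t ^ 2 := by
  have hsum : ∀ t : ℝ, (binomialSeries ℝ p).partialSum 2 t = 1 + p * t := fun t => by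
    simp [FormalMultilinearSeries.partialSum, binomialSeries, Finset.sum_range_succ, mul_comm]
  simpa [hsum, sub_sub] using Real.one_add_rpow_hasFPowerSeriesAt_zero (a := p)
    |>.isBigO_sub_partialSum_pow 2

/-- Up to a multiple of the integrand of the beta integral, a primitive of
`shiftGap (· ^ (κ - 1)) 1 s`. -/
noncomputable def gapPrimitive (s κ y : ℝ) : ℝ :=
  (s * (1 + y) ^ κ + (1 - s) * y ^ κ - y ^ (s + κ * (1 - s)) * (1 + y) ^ (s * (κ - 1)) -
    s * (y ^ (s + κ * (1 - s)) * (1 + y) ^ (s * (κ - 1) - 1))) / κ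

variable {s κ : ℝ}

lemma gapPrimitive_zero (hs : s ∈ Ioo (0 : ℝ) 1) (hκ : 0 < κ) : gapPrimitive s κ 0 = s / κ := by
  have ha : s + κ * (1 - s) ≠ 0 := (add_pos hs.1 (mul_pos hκ (sub_pos.2 hs.2))).ne'
  simp [gapPrimitive, Real.zero_rpow hκ.ne', Real.zero_rpow ha]

lemma continuousAt_gapPrimitive (hs : s ∈ Ioo (0 : ℝ) 1) (hκ : 0 < κ) :
    ContinuousAt (gapPrimitive s κ) 0 := by
  have ha : 0 < s + κ * (1 - s) := add_pos hs.1 (mul_pos hκ (sub_pos.2 hs.2))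
  have hone : ∀ p : ℝ, ContinuousAt (fun y : ℝ => (1 + y) ^ p) 0 := fun p =>
    ContinuousAt.rpow_const (by fun_prop) (.inl (by norm_num))
  have hκ' := Real.continuousAt_rpow_const 0 κ (.inr hκ.le)
  have ha' := Real.continuousAt_rpow_const 0 _ (.inr ha.le)
  exact ((((hone _).const_mul s).add (hκ'.const_mul (1 - s))).sub (ha'.mul (hone _))).sub
    ((ha'.mul (hone _)).const_mul s) |>.div_const κ

lemma hasDerivAt_gapPrimitive (hκ : 0 < κ) {y : ℝ} (hy : 0 < y) :
    HasDerivAt (gapPrimitive s κ)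
      (shiftGap (· ^ (κ - 1)) 1 s y - s * (1 - s * (κ - 1)) / κ *
        (y ^ (s + κ * (1 - s) - 1) * (1 + y) ^ (-(s + κ * (1 - s) + (2 - κ))))) y := by
  have hy1 : 0 < 1 + y := by linarith
  have hone : ∀ p : ℝ, HasDerivAt (fun y : ℝ => (1 + y) ^ p) (p * (1 + y) ^ (p - 1)) y := fun p =>
    by simpa using ((hasDerivAt_id y).const_add 1).rpow_const (p := p) (.inl hy1.ne')
  have hpow : ∀ p : ℝ, HasDerivAt (fun y : ℝ => y ^ p) (p * y ^ (p - 1)) y := fun p =>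
    Real.hasDerivAt_rpow_const (.inl hy.ne')
  have hprod : ∀ p q : ℝ, HasDerivAt (fun y : ℝ => y ^ p * (1 + y) ^ q)
      (p * y ^ (p - 1) * (1 + y) ^ q + y ^ p * (q * (1 + y) ^ (q - 1))) y := fun p q =>
    (hpow p).mul (hone q)
  convert! ((((hone κ).const_mul s).add ((hpow κ).const_mul (1 - s))).sub (hprod _ _)).sub
    ((hprod _ _).const_mul s) |>.div_const κ using 1
  have hgeom : ((1 + y) ^ (κ - 1)) ^ s * (y ^ (κ - 1)) ^ (1 - s) =
      y ^ (s + κ * (1 - s) - 1) * (1 + y) ^ (s * (κ - 1)) := by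
    rw [← Real.rpow_mul hy1.le, ← Real.rpow_mul hy.le, mul_comm]
    ring_nf
  have hsub_one : (1 + y) ^ (s * (κ - 1) - 1) = (1 + y) ^ (s * (κ - 1)) / (1 + y) := by
    rw [Real.rpow_sub hy1, Real.rpow_one]
  have hsub_two : (1 + y) ^ (s * (κ - 1) - 1 - 1) = (1 + y) ^ (s * (κ - 1)) / (1 + y) ^ 2 := by
    rw [sub_sub, one_add_one_eq_two, Real.rpow_sub hy1, Real.rpow_two]
  have hbeta : (1 + y) ^ (-(s + κ * (1 - s) + (2 - κ))) =
      (1 + y) ^ (s * (κ - 1)) / (1 + y) ^ 2 := by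
    rw [← Real.rpow_two, ← Real.rpow_sub hy1]
    ring_nf
  have hya : y ^ (s + κ * (1 - s)) = y ^ (s + κ * (1 - s) - 1) * y := by
    rw [Real.rpow_sub hy, Real.rpow_one, div_mul_cancel₀ _ hy.ne']
  simp only [shiftGap, meanGap]
  rw [add_comm y 1, hgeom, hsub_one, hsub_two, hbeta, hya]
  field_simp
  ring

lemma tendsto_gapPrimitive_atTop (hκ : κ < 2) : Tendsto (gapPrimitive s κ) atTop (𝓝 0) := by
  set r := s * (κ - 1) with hr
  set ψ : ℝ → ℝ := fun t =>
    s * (1 + t) ^ κ + (1 - s) - (1 + t) ^ r - s * (t * (1 + t) ^ (r - 1)) with hψ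
  have hψO : ψ =O[𝓝 0] fun t => t ^ 2 := by
    have hlin : (fun t : ℝ => (1 + t) ^ (r - 1) - 1) =O[𝓝 0] fun t => t := by
      have hd := (Real.one_add_rpow_hasFPowerSeriesAt_zero (a := r - 1)).differentiableAt
      simpa using hd.isBigO_sub
    have hmul : (fun t : ℝ => t * ((1 + t) ^ (r - 1) - 1)) =O[𝓝 0] fun t => t ^ 2 := by
      simpa only [sq] using (isBigO_refl _ _).mul hlin
    refine ((((one_add_rpow_sub_isBigO κ).const_mul_left s).sub (one_add_rpow_sub_isBigO r)).sub
      (hmul.const_mul_left s)).congr_left fun t => ?_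
    simp only [hψ, hr]
    ring
  have hlim : Tendsto (fun y : ℝ => y ^ κ / κ * (y⁻¹) ^ 2) atTop (𝓝 0) := by
    have hpow := (tendsto_rpow_neg_atTop (sub_pos.2 hκ)).div_const κ
    rw [zero_div] at hpow
    refine hpow.congr' ?_
    filter_upwards [eventually_gt_atTop 0] with y hy
    rw [neg_sub, Real.rpow_sub hy, Real.rpow_two]
    ring
  refine (((isBigO_refl (fun y : ℝ => y ^ κ / κ) atTop).mul
    (hψO.comp_tendsto tendsto_inv_atTop_zero)).trans_tendsto hlim).congr' ?_
  filter_upwards [eventually_gt_atTop 0] with y hy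
  have hone : ∀ p : ℝ, (1 + y) ^ p = y ^ p * (1 + y⁻¹) ^ p := fun p => by
    rw [← Real.mul_rpow hy.le (by positivity), mul_add, mul_inv_cancel₀ hy.ne', mul_one, add_comm]
  have hmul : y ^ (s + κ * (1 - s)) * y ^ r = y ^ κ := by
    rw [← Real.rpow_add hy, hr]
    ring_nf
  have hmul' : y ^ (s + κ * (1 - s)) * y ^ (r - 1) = y ^ κ * y⁻¹ := by
    rw [Real.rpow_sub hy, Real.rpow_one, mul_div_assoc', hmul, div_eq_mul_inv]
  simp only [gapPrimitive, Function.comp_apply, hψ, ← hr, hone]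
  rw [div_mul_eq_mul_div]
  congr 1
  linear_combination (1 + y⁻¹) ^ r * hmul + s * (1 + y⁻¹) ^ (r - 1) * hmul'

lemma integral_shiftGap_rpow (hκ : κ ∈ Ioo (0 : ℝ) 2) (hs : s ∈ Ioo (0 : ℝ) 1) :
    ∫ y in Ioi 0, shiftGap (· ^ (κ - 1)) 1 s y =
      s * (1 - s * (κ - 1)) / κ * ProbabilityTheory.beta (s + κ * (1 - s)) (2 - κ) - s / κ := by
  have ha : 0 < s + κ * (1 - s) := add_pos hs.1 (mul_pos hκ.1 (sub_pos.2 hs.2))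
  have hb : 0 < 2 - κ := sub_pos.2 hκ.2
  have hgap : IntegrableOn (shiftGap (· ^ (κ - 1)) 1 s) (Ioi 0) :=
    integrableOn_shiftGap_rpow ⟨by linarith [hκ.1], by linarith [hκ.2]⟩ hs
  have hbeta := (integrableOn_Ioi_beta ha hb).const_mul (s * (1 - s * (κ - 1)) / κ)
  have hftc := integral_Ioi_of_hasDerivAt_of_tendsto
    (continuousAt_gapPrimitive hs hκ.1).continuousWithinAt
    (fun y hy => hasDerivAt_gapPrimitive hκ.1 hy) (hgap.sub hbeta) (tendsto_gapPrimitive_atTop hκ.2)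
  rw [integral_sub hgap hbeta, integral_const_mul, integral_Ioi_eq_beta ha hb,
    gapPrimitive_zero hs hκ.1] at hftc
  linarith

end GapIntegral

/-! ### Exponents below two -/

lemma integral_Ioi_rescale {κ η ε : ℝ} (hε : 0 < ε) (g : ℝ → ℝ) :
    ∫ y in Ioi 0, ε ^ (1 - κ) * (Iic η).indicator g (ε * y) = (∫ x in Ioc 0 η, g x) / ε ^ κ := by
  rw [integral_const_mul, integral_comp_mul_left_Ioi _ _ hε, mul_zero,
    setIntegral_indicator measurableSet_Iic, Ioi_inter_Iic, smul_eq_mul, Real.rpow_sub hε,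
    Real.rpow_one]
  field_simp

namespace FirstOrderEndpoint

variable {f : ℝ → ℝ} {A κ : ℝ} (h : FirstOrderEndpoint f A κ)
include h

lemma tendsto_rescale {z : ℝ} (hz : 0 < z) :
    Tendsto (fun ε => ε ^ (1 - κ) * f (ε * z)) (𝓝[>] 0) (𝓝 (A * z ^ (κ - 1))) := by
  refine ((h.tendsto_div_rpow.comp (tendsto_const_mul_nhdsGT_zero hz)).mul_const
    (z ^ (κ - 1))).congr' ?_
  filter_upwards [self_mem_nhdsWithin] with ε (hε : 0 < ε)
  rw [Function.comp_apply, mul_comm z, Real.mul_rpow hε.le hz.le, ← neg_sub κ 1,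
    Real.rpow_neg hε.le]
  field_simp

lemma tendsto_rescale_shiftGap_sub (hf : IsHalfLineDensity f) {y : ℝ} (hy : 0 < y) :
    Tendsto (fun q : ℝ × ℝ => q.1 ^ (1 - κ) * shiftGap f q.1 q.2 (q.1 * y) -
      A * shiftGap (· ^ (κ - 1)) 1 q.2 y) shiftFilter (𝓝 0) := by
  have hA := h.A_pos
  refine (tendsto_meanGap_sub_meanGap (eventually_shiftFilter.mono fun q hq => hq.2)
    (by positivity) (by positivity)
    ((h.tendsto_rescale (by positivity : 0 < y + 1)).comp tendsto_fst)
    ((h.tendsto_rescale hy).comp tendsto_fst)).congr' ?_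
  filter_upwards [eventually_shiftFilter] with q ⟨hε, _⟩
  simp only [Function.comp_apply, shiftGap]
  rw [meanGap_mul (by positivity) (hf.nonneg _) (hf.nonneg _),
    meanGap_mul hA.le (by positivity) (by positivity), mul_add, mul_one]

lemma exists_abs_rescale_shiftGap_sub_le (hf : IsHalfLineDensity f) :
    ∃ η > 0, ∃ K, ∀ s ∈ Ioo (0 : ℝ) 1, ∀ ε ∈ Ioo 0 η, ∀ y > 0,
      |ε ^ (1 - κ) * (Iic η).indicator (shiftGap f ε s) (ε * y) -
        A * shiftGap (· ^ (κ - 1)) 1 s y| ≤ K * scaleBound (κ - 1) y := by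
  obtain ⟨R, hR, c, hc, C, hpow⟩ := h.exists_isPowerLikeOn hf
  obtain ⟨K, hK, hgap⟩ := hpow.exists_shiftGap_le_scaleBound hc
  obtain ⟨K', -, hgap'⟩ := exists_shiftGap_rpow_le (κ - 1)
  refine ⟨R / 2, half_pos hR, K + A * K', fun s hs ε hε y hy => ?_⟩
  have hε0 := hε.1
  have hA := h.A_pos
  have hy0 : 0 ≤ scaleBound (κ - 1) y := scaleBound_nonneg hy.le
  have hrescaled : ε ^ (1 - κ) * (Iic (R / 2)).indicator (shiftGap f ε s) (ε * y) ∈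
      Icc 0 (K * scaleBound (κ - 1) y) := by
    by_cases hmem : ε * y ∈ Iic (R / 2)
    · rw [indicator_of_mem hmem]
      refine ⟨mul_nonneg (by positivity) (shiftGap_nonneg hf hs), ?_⟩
      have hle := hgap s hs (ε * y) ε (by positivity) hε0 fun z hz =>
        ⟨(mul_pos hε0 hy).trans_le hz.1, by linarith [hz.2, hε.2, mem_Iic.1 hmem]⟩
      rw [mul_div_cancel_left₀ y hε0.ne'] at hle
      calc ε ^ (1 - κ) * shiftGap f ε s (ε * y)
          ≤ ε ^ (1 - κ) * (K * (ε ^ (κ - 1) * scaleBound (κ - 1) y)) := by gcongr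
        _ = K * scaleBound (κ - 1) y := by
          rw [← neg_sub κ 1, Real.rpow_neg hε0.le]
          field_simp
    · rw [indicator_of_notMem hmem, mul_zero]
      exact ⟨le_rfl, by positivity⟩
  have hmodel : A * shiftGap (· ^ (κ - 1)) 1 s y ∈ Icc 0 (A * K' * scaleBound (κ - 1) y) := by
    refine ⟨mul_nonneg hA.le (meanGap_nonneg hs (by positivity) (by positivity)), ?_⟩
    rw [mul_assoc]
    gcongr
    exact hgap' s hs y hy
  rw [abs_le]
  constructor <;> nlinarith [hrescaled.1, hrescaled.2, hmodel.1, hmodel.2]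

lemma exists_tendsto_integral_Ioc_shiftGap_div (hf : IsHalfLineDensity f) (hκ : κ < 2) :
    ∃ η > 0, Tendsto (fun q : ℝ × ℝ => (∫ x in Ioc 0 η, shiftGap f q.1 q.2 x) / q.1 ^ κ -
      A * ∫ y in Ioi 0, shiftGap (· ^ (κ - 1)) 1 q.2 y) shiftFilter (𝓝 0) := by
  have hκ' : κ - 1 ∈ Ioo (-1 : ℝ) 1 := ⟨by linarith [h.kappa_pos], by linarith⟩
  obtain ⟨η, hη, K, hbound⟩ := h.exists_abs_rescale_shiftGap_sub_le hf
  have hsmall : ∀ r > 0, ∀ᶠ q in shiftFilter, q.1 ∈ Ioo 0 r := fun r hr =>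
    tendsto_fst.eventually (Ioo_mem_nhdsGT hr)
  have hint : ∀ q : ℝ × ℝ, q.1 ∈ Ioo 0 η → q.2 ∈ Ioo (0 : ℝ) 1 → IntegrableOn (fun y =>
      q.1 ^ (1 - κ) * (Iic η).indicator (shiftGap f q.1 q.2) (q.1 * y)) (Ioi 0) := fun q hε hs =>
    ((((integrable_shiftGap hf q.1 hs).indicator measurableSet_Iic).comp_mul_left'
      hε.1.ne').const_mul _).integrableOn
  have hmodel : ∀ s ∈ Ioo (0 : ℝ) 1,
      IntegrableOn (fun y => A * shiftGap (· ^ (κ - 1)) 1 s y) (Ioi 0) := fun s hs =>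
    (integrableOn_shiftGap_rpow hκ' hs).const_mul A
  have hlim := tendsto_integral_filter_of_dominated_convergence (l := shiftFilter)
    (μ := volume.restrict (Ioi 0)) (f := fun _ => (0 : ℝ))
    (F := fun q y => q.1 ^ (1 - κ) * (Iic η).indicator (shiftGap f q.1 q.2) (q.1 * y) -
      A * shiftGap (· ^ (κ - 1)) 1 q.2 y) (fun y => K * scaleBound (κ - 1) y) ?_ ?_
    ((integrableOn_scaleBound hκ').const_mul K) ?_
  · rw [integral_zero] at hlim
    refine ⟨η, hη, hlim.congr' ?_⟩
    filter_upwards [hsmall η hη, eventually_shiftFilter] with q hε ⟨_, hs⟩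
    rw [integral_sub (hint q hε hs) (hmodel q.2 hs), integral_Ioi_rescale hε.1, integral_const_mul]
  · filter_upwards [hsmall η hη, eventually_shiftFilter] with q hε ⟨_, hs⟩
    exact ((hint q hε hs).sub (hmodel q.2 hs)).aestronglyMeasurable
  · filter_upwards [hsmall η hη, eventually_shiftFilter] with q hε ⟨_, hs⟩
    filter_upwards [ae_restrict_mem measurableSet_Ioi] with y hy using hbound q.2 hs q.1 hε y hy
  · filter_upwards [ae_restrict_mem measurableSet_Ioi] with y (hy : 0 < y)
    refine (h.tendsto_rescale_shiftGap_sub hf hy).congr' ?_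
    filter_upwards [hsmall (η / y) (by positivity)] with q hε
    rw [indicator_of_mem (mem_Iic.2 ((lt_div_iff₀ hy).1 hε.2).le)]

lemma tendsto_deficit_div_of_lt_two (hf : IsHalfLineDensity f) (ht : TailCondition f)
    (hκ : κ < 2) :
    Tendsto (fun q : ℝ × ℝ => deficit f q.1 q.2 / q.1 ^ κ - A * q.2 * (1 - q.2 * (κ - 1)) *
      ProbabilityTheory.beta (q.2 + κ * (1 - q.2)) (2 - κ) / κ) shiftFilter (𝓝 0) := by
  obtain ⟨η, hη, hnear⟩ := h.exists_tendsto_integral_Ioc_shiftGap_div hf hκ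
  have hsq : Tendsto (fun ε : ℝ => ε ^ 2 / ε ^ κ) (𝓝[>] 0) (𝓝 0) := by
    refine (tendsto_rpow_nhdsGT_zero (sub_pos.2 hκ)).congr' ?_
    filter_upwards [self_mem_nhdsWithin] with ε hε
    rw [Real.rpow_sub hε, Real.rpow_two]
  refine tendsto_deficit_div_of_near (L := fun s => A * s * (1 - s * (κ - 1)) *
    ProbabilityTheory.beta (s + κ * (1 - s)) (2 - κ) / κ) hf ht hsq (h.tendsto_integral_Ioc_div hf)
    fun τ hτ => ⟨η, hη, ?_⟩
  filter_upwards [Metric.tendsto_nhds.1 hnear τ hτ, eventually_shiftFilter] with q hq ⟨_, hs⟩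
  rw [Real.dist_0_eq_abs, integral_shiftGap_rpow ⟨h.kappa_pos, hκ⟩ hs] at hq
  refine le_of_eq_of_le (congrArg abs ?_) hq.le
  ring

lemma uniformLimit_of_lt_two (hf : IsHalfLineDensity f) (ht : TailCondition f) (hκ : κ < 2)
    (θ : ℝ) : UniformLimit (fun ε s => relRenyi s (shift f θ) (shift f (θ + ε)) / ε ^ κ)
      (fun s => A * s * (1 - s * (κ - 1)) *
        ProbabilityTheory.beta (s + κ * (1 - s)) (2 - κ) / κ) := by
  have hpos : ∀ᶠ ε : ℝ in 𝓝[>] 0, 0 < ε ^ κ := by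
    filter_upwards [self_mem_nhdsWithin] with ε hε using Real.rpow_pos_of_pos hε κ
  exact uniformLimit_relRenyi hf hpos (tendsto_rpow_nhdsGT_zero h.kappa_pos)
    (h.tendsto_deficit_div_of_lt_two hf ht hκ) θ

end FirstOrderEndpoint

lemma add_mul_beta_add_one {a b : ℝ} (ha : 0 < a) (hb : 0 < b) :
    (a + b) * ProbabilityTheory.beta a (b + 1) = b * ProbabilityTheory.beta a b := by
  have hGamma := (Real.Gamma_pos_of_pos (add_pos ha hb)).ne'
  rw [ProbabilityTheory.beta, ProbabilityTheory.beta, Real.Gamma_add_one hb.ne', ← add_assoc,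
    Real.Gamma_add_one (add_pos ha hb).ne']
  field_simp [hGamma]

lemma beta_one_one : ProbabilityTheory.beta 1 1 = 1 := by
  rw [ProbabilityTheory.beta, one_add_one_eq_two, Real.Gamma_one, Real.Gamma_two, mul_one, div_one]

namespace FirstOrderEndpoint

variable {f : ℝ → ℝ} {A κ : ℝ} (h : FirstOrderEndpoint f A κ)
include h

lemma uniformLimit_of_lt_one (hf : IsHalfLineDensity f) (ht : TailCondition f) (hκ : κ < 1)
    (θ : ℝ) : UniformLimit (fun ε s => relRenyi s (shift f θ) (shift f (θ + ε)) / ε ^ κ)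
      (fun s => (1 - κ) / κ * (A * s * ProbabilityTheory.beta (s + κ * (1 - s)) (1 - κ))) := by
  refine (h.uniformLimit_of_lt_two hf ht (by linarith) θ).congr_right fun s hs => ?_
  have ha : 0 < s + κ * (1 - s) := add_pos hs.1 (mul_pos h.kappa_pos (sub_pos.2 hs.2))
  have hbeta := add_mul_beta_add_one ha (sub_pos.2 hκ)
  rw [show 1 - κ + 1 = 2 - κ by ring,
    show s + κ * (1 - s) + (1 - κ) = 1 - s * (κ - 1) by ring] at hbeta
  linear_combination A * s / κ * hbeta

lemma uniformLimit_of_eq_one (hf : IsHalfLineDensity f) (ht : TailCondition f) (hκ : κ = 1)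
    (θ : ℝ) : UniformLimit (fun ε s => relRenyi s (shift f θ) (shift f (θ + ε)) / ε ^ κ)
      (fun s => A * s) := by
  refine (h.uniformLimit_of_lt_two hf ht (by linarith) θ).congr_right fun s _ => ?_
  beta_reduce
  rw [hκ, one_mul, add_sub_cancel, show (2 : ℝ) - 1 = 1 by norm_num, beta_one_one]
  ring

end FirstOrderEndpoint

/-! ### Exponents above two -/

lemma integral_Ioc_shiftGap_le {f : ℝ → ℝ} (hf : IsHalfLineDensity f) {s ε a : ℝ}
    (hs : s ∈ Ioo (0 : ℝ) 1) (hε : 0 ≤ ε) (ha : 0 ≤ a) :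
    ∫ x in Ioc 0 a, shiftGap f ε s x ≤ 2 * ∫ x in Ioc 0 (a + ε), f x := by
  have hmono : ∀ {S : Set ℝ}, S ⊆ Ioc 0 (a + ε) → ∫ x in S, f x ≤ ∫ x in Ioc 0 (a + ε), f x :=
    fun hS => setIntegral_mono_set hf.integrable.integrableOn (.of_forall hf.nonneg)
      hS.eventuallyLE
  calc ∫ x in Ioc 0 a, shiftGap f ε s x ≤ ∫ x in Ioc 0 a, (f (x + ε) + f x) :=
        integral_mono (integrable_shiftGap hf ε hs).integrableOn
          ((hf.integrable.comp_add_right ε).integrableOn.add hf.integrable.integrableOn)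
          fun x => shiftGap_le_add hf hs
    _ = (∫ x in Ioc ε (a + ε), f x) + ∫ x in Ioc 0 a, f x := by
        rw [integral_add (hf.integrable.comp_add_right ε).integrableOn hf.integrable.integrableOn,
          ← intervalIntegral.integral_of_le ha,
          intervalIntegral.integral_comp_add_right f ε, zero_add,
          intervalIntegral.integral_of_le (by linarith)]
    _ ≤ _ := by
        rw [two_mul]
        exact add_le_add (hmono (Ioc_subset_Ioc_left hε))
          (hmono (Ioc_subset_Ioc_right (by linarith)))

lemma integral_Ioc_rpow {p : ℝ} (hp : -1 < p) {η : ℝ} (hη : 0 ≤ η) :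
    ∫ x in Ioc 0 η, x ^ p = η ^ (p + 1) / (p + 1) := by
  rw [← intervalIntegral.integral_of_le hη, integral_rpow (.inl hp),
    Real.zero_rpow (by linarith), sub_zero]

lemma tendsto_rpow_div_sq {κ : ℝ} (hκ : 2 < κ) :
    Tendsto (fun ε : ℝ => ε ^ κ / ε ^ 2) (𝓝[>] 0) (𝓝 0) := by
  refine (tendsto_rpow_nhdsGT_zero (sub_pos.2 hκ)).congr' ?_
  filter_upwards [self_mem_nhdsWithin] with ε hε
  rw [Real.rpow_sub hε, Real.rpow_two]

namespace FirstOrderEndpoint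

variable {f : ℝ → ℝ} {A κ : ℝ} (h : FirstOrderEndpoint f A κ) (hf : IsHalfLineDensity f)
include h hf

lemma exists_integral_Ioc_mul_shiftGap_le {K : ℝ} (hK : 0 < K) :
    ∃ B, ∀ᶠ q : ℝ × ℝ in shiftFilter,
      ∫ x in Ioc 0 (K * q.1), shiftGap f q.1 q.2 x ≤ B * q.1 ^ κ := by
  have hK1 : 0 < K + 1 := by positivity
  have hbound : ∀ᶠ ε in 𝓝[>] (0 : ℝ), (∫ x in Ioc 0 ((K + 1) * ε), f x) / ((K + 1) * ε) ^ κ <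
      A / κ + 1 :=
    ((h.tendsto_integral_Ioc_div hf).comp (tendsto_const_mul_nhdsGT_zero hK1)).eventually_lt_const
      (lt_add_one _)
  refine ⟨2 * ((A / κ + 1) * (K + 1) ^ κ), ?_⟩
  filter_upwards [tendsto_fst.eventually hbound, eventually_shiftFilter] with q hq ⟨hε, hs⟩
  rw [div_lt_iff₀ (by positivity), Real.mul_rpow hK1.le hε.le, add_mul, one_mul] at hq
  have hgap := integral_Ioc_shiftGap_le hf hs hε.le (mul_pos hK hε).le
  linarith

lemma tendsto_integral_Ioc_div_zero {φ : ℝ → ℝ}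
    (hφ : Tendsto (fun ε => ε ^ κ / φ ε) (𝓝[>] 0) (𝓝 0)) :
    Tendsto (fun ε => (∫ x in Ioc 0 ε, f x) / φ ε) (𝓝[>] 0) (𝓝 0) := by
  have hprod := (h.tendsto_integral_Ioc_div hf).mul hφ
  rw [mul_zero] at hprod
  refine hprod.congr' ?_
  filter_upwards [self_mem_nhdsWithin] with ε (hε : 0 < ε)
  exact div_mul_div_cancel₀ (by positivity)

lemma exists_integral_Ioc_inv_mul_deriv_sq_le (hκ : 2 < κ) :
    ∃ R > 0, ∃ E, ∀ η ∈ Ioo 0 R, IntegrableOn (fun x => (f x)⁻¹ * deriv f x ^ 2) (Ioc 0 η) ∧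
      ∫ x in Ioc 0 η, (f x)⁻¹ * deriv f x ^ 2 ≤ E * η ^ (κ - 2) := by
  obtain ⟨R, hR, c, hc, C, hpow⟩ := h.exists_isPowerLikeOn hf
  refine ⟨R, hR, C ^ 2 / c / (κ - 2), fun η hη => ?_⟩
  have hexp : -1 < κ - 3 := by linarith
  have hle : ∀ x ∈ Ioc 0 η, (f x)⁻¹ * deriv f x ^ 2 ≤ C ^ 2 / c * x ^ (κ - 3) := fun x hx => by
    have hx' := hpow.inv_mul_deriv_sq_le hc hx.1 ⟨hx.1, hx.2.trans_lt hη.2⟩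
    rwa [sub_sub, show (1 : ℝ) + 2 = 3 by norm_num] at hx'
  have hmajor := (integrableOn_Ioc_rpow hexp hη.1.le).const_mul (C ^ 2 / c)
  have hint : IntegrableOn (fun x => (f x)⁻¹ * deriv f x ^ 2) (Ioc 0 η) := by
    refine hmajor.mono' ((hf.continuousOn_inv_mul_deriv_sq.mono
      Ioc_subset_Ioi_self).aestronglyMeasurable measurableSet_Ioc) ?_
    filter_upwards [ae_restrict_mem measurableSet_Ioc] with x hx
    rw [Real.norm_of_nonneg (mul_nonneg (inv_nonneg.2 (hf.nonneg x)) (sq_nonneg _))]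
    exact hle x hx
  refine ⟨hint, (setIntegral_mono_on hint hmajor measurableSet_Ioc hle).trans_eq ?_⟩
  rw [integral_const_mul, integral_Ioc_rpow hexp hη.1.le, show κ - 3 + 1 = κ - 2 by ring]
  ring

lemma exists_integral_Ioc_shiftGap_le (hκ : 2 < κ) :
    ∃ R > 0, ∃ B D, ∀ η ∈ Ioo 0 R, ∀ᶠ q : ℝ × ℝ in shiftFilter,
      ∫ x in Ioc 0 η, shiftGap f q.1 q.2 x ≤ B * q.1 ^ κ + D * η ^ (κ - 2) * q.1 ^ 2 := by
  obtain ⟨R, hR, c, hc, C, hpow⟩ := h.exists_isPowerLikeOn hf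
  obtain ⟨D, hD, hgap⟩ := hpow.exists_shiftGap_le_rpow_mul_sq hc
  obtain ⟨B, hB⟩ := h.exists_integral_Ioc_mul_shiftGap_le hf one_pos
  have hexp : -1 < κ - 3 := by linarith
  refine ⟨R, hR, B, D / (κ - 2), fun η hη => ?_⟩
  have hsmall : ∀ᶠ ε in 𝓝[>] (0 : ℝ), ε ∈ Ioo 0 (min η (R - η)) :=
    Ioo_mem_nhdsGT (lt_min hη.1 (sub_pos.2 hη.2))
  filter_upwards [tendsto_fst.eventually hsmall, eventually_shiftFilter, hB]
    with ⟨ε, s⟩ hε ⟨hε0, hs⟩ hB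
  dsimp only at hε hε0 hs hB ⊢
  rw [one_mul] at hB
  obtain ⟨hεη, hεR⟩ := lt_min_iff.1 hε.2
  have hmajor : IntegrableOn (fun x => D * (x ^ (κ - 3) * ε ^ 2)) (Ioc 0 η) :=
    ((integrableOn_Ioc_rpow hexp hη.1.le).mul_const (ε ^ 2)).const_mul D
  have hsub : Ioc ε η ⊆ Ioc 0 η := Ioc_subset_Ioc_left hε0.le
  have hint : ∀ S, IntegrableOn (shiftGap f ε s) S := fun S =>
    (integrable_shiftGap hf ε hs).integrableOn
  have houter : ∫ x in Ioc ε η, shiftGap f ε s x ≤ D / (κ - 2) * η ^ (κ - 2) * ε ^ 2 :=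
    calc ∫ x in Ioc ε η, shiftGap f ε s x ≤ ∫ x in Ioc ε η, D * (x ^ (κ - 3) * ε ^ 2) := by
          refine setIntegral_mono_on (hint _) (hmajor.mono_set hsub) measurableSet_Ioc
            fun x hx => ?_
          have hx' := hgap s hs x ε hε0 hx.1.le fun z hz =>
            ⟨(hε0.trans hx.1).trans_le hz.1, by linarith [hz.2, hx.2]⟩
          rwa [sub_sub, show (1 : ℝ) + 2 = 3 by norm_num] at hx'
      _ ≤ ∫ x in Ioc 0 η, D * (x ^ (κ - 3) * ε ^ 2) := by
          refine setIntegral_mono_set hmajor ?_ hsub.eventuallyLE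
          filter_upwards [ae_restrict_mem measurableSet_Ioc] with x hx
          have := hx.1
          positivity
      _ = _ := by
          rw [integral_const_mul, integral_mul_const, integral_Ioc_rpow hexp hη.1.le,
            show κ - 3 + 1 = κ - 2 by ring]
          ring
  rw [← Ioc_union_Ioc_eq_Ioc hε0.le hεη.le, setIntegral_union
    (Ioc_disjoint_Ioc_of_le le_rfl) measurableSet_Ioc (hint _) (hint _)]
  exact add_le_add hB houter

lemma integrableOn_inv_mul_deriv_sq (ht : TailCondition f) (hκ : 2 < κ) :
    IntegrableOn (fun x => (f x)⁻¹ * deriv f x ^ 2) (Ioi 0) := by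
  obtain ⟨R, hR, _, hE⟩ := h.exists_integral_Ioc_inv_mul_deriv_sq_le hf hκ
  have hη : R / 2 ∈ Ioo 0 R := ⟨half_pos hR, half_lt_self hR⟩
  rw [← Ioc_union_Ioi_eq_Ioi hη.1.le]
  exact (hE _ hη).1.union (ht.integrableOn_inv_mul_deriv_sq hf hη.1)

lemma exists_abs_integral_Ioc_shiftGap_div_sub_le (hκ : 2 < κ) {τ : ℝ} (hτ : 0 < τ) :
    ∃ η > 0, IntegrableOn (fun x => (f x)⁻¹ * deriv f x ^ 2) (Ioc 0 η) ∧
      ∀ᶠ q : ℝ × ℝ in shiftFilter, |(∫ x in Ioc 0 η, shiftGap f q.1 q.2 x) / q.1 ^ 2 -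
        q.2 * (1 - q.2) / 2 * ∫ x in Ioc 0 η, (f x)⁻¹ * deriv f x ^ 2| ≤ τ := by
  obtain ⟨R, hR, E, hE⟩ := h.exists_integral_Ioc_inv_mul_deriv_sq_le hf hκ
  obtain ⟨R', hR', B, D, hgap⟩ := h.exists_integral_Ioc_shiftGap_le hf hκ
  have hηlim : ∀ a : ℝ, ∀ᶠ η : ℝ in 𝓝[>] 0, a * η ^ (κ - 2) < τ / 2 := fun a => by
    have ha := (tendsto_rpow_nhdsGT_zero (sub_pos.2 hκ)).const_mul a
    rw [mul_zero] at ha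
    exact ha.eventually_lt_const (half_pos hτ)
  have hBlim : ∀ᶠ ε : ℝ in 𝓝[>] 0, B * (ε ^ κ / ε ^ 2) < τ / 2 := by
    have hB := (tendsto_rpow_div_sq hκ).const_mul B
    rw [mul_zero] at hB
    exact hB.eventually_lt_const (half_pos hτ)
  obtain ⟨η, hηE, hηD, hη⟩ := ((hηlim E).and ((hηlim D).and
    (Ioo_mem_nhdsGT (lt_min hR hR')))).exists
  obtain ⟨hηR, hηR'⟩ := lt_min_iff.1 hη.2
  obtain ⟨hint, hJ⟩ := hE η ⟨hη.1, hηR⟩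
  refine ⟨η, hη.1, hint, ?_⟩
  filter_upwards [hgap η ⟨hη.1, hηR'⟩, eventually_shiftFilter, tendsto_fst.eventually hBlim]
    with ⟨ε, s⟩ hgap ⟨hε, hs⟩ hB
  dsimp only at hgap hε hs hB ⊢
  have hN0 : 0 ≤ (∫ x in Ioc 0 η, shiftGap f ε s x) / ε ^ 2 :=
    div_nonneg (integral_nonneg fun x => shiftGap_nonneg hf hs) (sq_nonneg ε)
  have hN : (∫ x in Ioc 0 η, shiftGap f ε s x) / ε ^ 2 ≤ τ := by
    rw [← mul_div_assoc, div_lt_iff₀ (by positivity)] at hB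
    rw [div_le_iff₀ (by positivity)]
    nlinarith [sq_nonneg ε]
  have hJ0 : 0 ≤ ∫ x in Ioc 0 η, (f x)⁻¹ * deriv f x ^ 2 :=
    integral_nonneg fun x => mul_nonneg (inv_nonneg.2 (hf.nonneg x)) (sq_nonneg _)
  have hs1 : s * (1 - s) / 2 ∈ Icc (0 : ℝ) 1 :=
    ⟨by nlinarith [hs.1, hs.2], by nlinarith [hs.2, sq_nonneg s]⟩
  rw [abs_le]
  constructor <;> linarith [mul_nonneg hs1.1 hJ0, mul_le_of_le_one_left hJ0 hs1.2]

lemma tendsto_deficit_div_of_two_lt (ht : TailCondition f) (hκ : 2 < κ) :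
    Tendsto (fun q : ℝ × ℝ => deficit f q.1 q.2 / q.1 ^ 2 - q.2 * (1 - q.2) / 2 * fisherInfo f)
      shiftFilter (𝓝 0) := by
  have hsq : Tendsto (fun ε : ℝ => ε ^ 2 / ε ^ 2) (𝓝[>] 0) (𝓝 1) :=
    tendsto_const_nhds.congr' <| by
      filter_upwards [self_mem_nhdsWithin] with ε (hε : 0 < ε) using (div_self (by positivity)).symm
  refine tendsto_deficit_div_of_near (L := fun s => s * (1 - s) / 2 * fisherInfo f) hf ht hsq
    (h.tendsto_integral_Ioc_div_zero hf (tendsto_rpow_div_sq hκ)) fun τ hτ => ?_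
  obtain ⟨η, hη, hint, hnear⟩ := h.exists_abs_integral_Ioc_shiftGap_div_sub_le hf hκ hτ
  have hsplit : fisherInfo f = (∫ x in Ioc 0 η, (f x)⁻¹ * deriv f x ^ 2) +
      ∫ x in Ioi η, (f x)⁻¹ * deriv f x ^ 2 := by
    rw [fisherInfo, ← Ioc_union_Ioi_eq_Ioi hη.le, setIntegral_union
      (Ioc_disjoint_Ioi le_rfl) measurableSet_Ioi hint (ht.integrableOn_inv_mul_deriv_sq hf hη)]
  refine ⟨η, hη, hnear.mono fun q hq => le_of_eq_of_le (congrArg abs ?_) hq⟩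
  rw [hsplit]
  ring

lemma uniformLimit_of_two_lt (ht : TailCondition f) (hκ : 2 < κ) (θ : ℝ) :
    UniformLimit (fun ε s => relRenyi s (shift f θ) (shift f (θ + ε)) / ε ^ 2)
      (fun s => s * (1 - s) / 2 * fisherInfo f) := by
  have hpos : ∀ᶠ ε : ℝ in 𝓝[>] 0, 0 < ε ^ 2 := by
    filter_upwards [self_mem_nhdsWithin] with ε (hε : 0 < ε) using by positivity
  have hzero : Tendsto (fun ε : ℝ => ε ^ 2) (𝓝[>] 0) (𝓝 0) := by
    simpa using tendsto_rpow_nhdsGT_zero two_pos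
  exact uniformLimit_relRenyi hf hpos hzero (h.tendsto_deficit_div_of_two_lt hf ht hκ) θ

end FirstOrderEndpoint

/-! ### Exponent two -/

lemma abs_meanGap_add_sub_le {s A P Q x ε : ℝ} (hs : s ∈ Ioo (0 : ℝ) 1) (hP : 0 ≤ P) (hQ : 0 < Q)
    (hx : 0 < x) (hε : 0 ≤ ε) :
    |meanGap s (Q * x + P * ε) (Q * x) - s * (1 - s) / 2 * A * (ε ^ 2 * x⁻¹)| ≤
      (|P ^ 2 / Q - A| + (Q + P * (ε / x)) * (P / Q) ^ 3 * (ε / x)) * (ε ^ 2 * x⁻¹) := by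
  have hs1 : s * (1 - s) / 2 ∈ Icc (0 : ℝ) 1 :=
    ⟨by nlinarith [hs.1, hs.2], by nlinarith [hs.2, sq_nonneg s]⟩
  have hgap := abs_meanGap_sub_sq_div_le hs (by positivity : 0 < Q * x)
    (le_add_of_nonneg_right (by positivity : 0 ≤ P * ε))
  rw [add_sub_cancel_left] at hgap
  have hcoeff : |s * (1 - s) / 2 * ((P * ε) ^ 2 / (Q * x)) - s * (1 - s) / 2 * A * (ε ^ 2 * x⁻¹)| ≤
      |P ^ 2 / Q - A| * (ε ^ 2 * x⁻¹) :=
    calc _ = s * (1 - s) / 2 * (|P ^ 2 / Q - A| * (ε ^ 2 * x⁻¹)) := by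
          rw [show s * (1 - s) / 2 * ((P * ε) ^ 2 / (Q * x)) - s * (1 - s) / 2 * A * (ε ^ 2 * x⁻¹) =
            s * (1 - s) / 2 * ((P ^ 2 / Q - A) * (ε ^ 2 * x⁻¹)) by field_simp, abs_mul, abs_mul,
            abs_of_nonneg hs1.1, abs_of_nonneg (by positivity : 0 ≤ ε ^ 2 * x⁻¹)]
      _ ≤ _ := mul_le_of_le_one_left (by positivity) hs1.2
  refine (abs_sub_le _ _ _).trans ((add_le_add hgap hcoeff).trans_eq ?_)
  field_simp
  ring

lemma exists_meanGap_error_lt {A τ : ℝ} (hA : 0 < A) (hτ : 0 < τ) :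
    ∃ σ > 0, ∀ P Q u : ℝ, |P - A| < σ → |Q - A| < σ → |u| < σ →
      |P ^ 2 / Q - A| + (Q + P * u) * (P / Q) ^ 3 * u < τ := by
  have hcont : ContinuousAt (fun p : ℝ × ℝ × ℝ => |p.1 ^ 2 / p.2.1 - A| +
      (p.2.1 + p.1 * p.2.2) * (p.1 / p.2.1) ^ 3 * p.2.2) (A, A, 0) := by
    fun_prop (disch := exact hA.ne')
  obtain ⟨σ, hσ, hball⟩ := Metric.eventually_nhds_iff.1 <| hcont.eventually_lt_const
    (u := τ) (by simpa [sq, hA.ne'] using hτ)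
  refine ⟨σ, hσ, fun P Q u hP hQ hu => hball (y := (P, Q, u)) ?_⟩
  simp only [Prod.dist_eq, Real.dist_eq, sub_zero, sup_lt_iff]
  exact ⟨hP, hQ, hu⟩

lemma abs_add_div_sub_le {N₁ N₂ W A B τ φ ψ : ℝ} (hφ : 0 < φ) (hN₁ : N₁ ∈ Icc 0 B)
    (hN₂ : |N₂ - W * ψ| ≤ τ * ψ) (hW : W ∈ Icc 0 A) :
    |(N₁ + N₂) / φ - W| ≤ B / φ + τ * (ψ / φ) + A * |ψ / φ - 1| := by
  have h₁ : |N₁ / φ| ≤ B / φ := by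
    rw [abs_of_nonneg (div_nonneg hN₁.1 hφ.le)]
    gcongr
    exact hN₁.2
  have h₂ : |(N₂ - W * ψ) / φ| ≤ τ * (ψ / φ) := by
    rw [abs_div, abs_of_pos hφ, ← mul_div_assoc]
    gcongr
  have h₃ : |W * (ψ / φ - 1)| ≤ A * |ψ / φ - 1| := by
    rw [abs_mul, abs_of_nonneg hW.1]
    gcongr
    exact hW.2
  calc |(N₁ + N₂) / φ - W| = |N₁ / φ + (N₂ - W * ψ) / φ + W * (ψ / φ - 1)| := by ring_nf
    _ ≤ _ := (abs_add_three _ _ _).trans (add_le_add_three h₁ h₂ h₃)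

lemma integrableOn_Ioc_inv {a b : ℝ} (ha : 0 < a) : IntegrableOn (fun x : ℝ => x⁻¹) (Ioc a b) :=
  ((continuousOn_id.inv₀ fun _ hx => (ha.trans_le hx.1).ne').integrableOn_Icc).mono_set
    Ioc_subset_Icc_self

lemma tendsto_log_div_neg_log {a b : ℝ} (ha : 0 < a) (hb : 0 < b) :
    Tendsto (fun ε : ℝ => Real.log (a / (b * ε)) / -Real.log ε) (𝓝[>] 0) (𝓝 1) := by
  have hlog : Tendsto (fun ε : ℝ => -Real.log ε) (𝓝[>] 0) atTop :=
    tendsto_neg_atBot_atTop.comp Real.tendsto_log_nhdsGT_zero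
  have hsum := (hlog.const_div_atTop (Real.log (a / b))).add_const 1
  rw [zero_add] at hsum
  refine hsum.congr' ?_
  filter_upwards [self_mem_nhdsWithin, hlog.eventually_ne_atTop 0] with ε (hε : 0 < ε) hne
  rw [← div_div, Real.log_div (by positivity) hε.ne', sub_eq_add_neg, add_div, div_self hne]

namespace FirstOrderEndpoint

variable {f : ℝ → ℝ} {A : ℝ} (h : FirstOrderEndpoint f A 2) (hf : IsHalfLineDensity f)
include h hf

lemma exists_abs_shiftGap_sub_le {τ : ℝ} (hτ : 0 < τ) :
    ∃ K > 0, ∃ R > 0, ∀ s ∈ Ioo (0 : ℝ) 1, ∀ x ε : ℝ, 0 < ε → K * ε < x → x + ε < R →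
      |shiftGap f ε s x - s * (1 - s) / 2 * A * (ε ^ 2 * x⁻¹)| ≤ τ * (ε ^ 2 * x⁻¹) := by
  have hA := h.A_pos
  obtain ⟨σ, hσ, herror⟩ := exists_meanGap_error_lt hA hτ
  have hQlim : ∀ᶠ x in 𝓝[>] (0 : ℝ), |f x / x - A| < min σ A := by
    have hratio := h.tendsto_div_rpow
    norm_num at hratio
    simpa only [Real.dist_eq] using Metric.tendsto_nhds.1 hratio _ (lt_min hσ hA)
  have hPlim : ∀ᶠ x in 𝓝[>] (0 : ℝ), |deriv f x - A| < min σ A := by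
    simpa only [Real.dist_eq] using
      Metric.tendsto_nhds.1 (h.tendsto_deriv_of_two rfl) _ (lt_min hσ hA)
  obtain ⟨R, hR, hnear⟩ := mem_nhdsGT_iff_exists_Ioo_subset.1 (hQlim.and hPlim)
  refine ⟨σ⁻¹, by positivity, R, hR, fun s hs x ε hε hx hxR => ?_⟩
  have hx0 : 0 < x := (by positivity : 0 < σ⁻¹ * ε).trans hx
  obtain ⟨ξ, hξ, hmean⟩ := exists_deriv_eq_slope f (lt_add_of_pos_right x hε)
    (hf.continuousOn.mono fun y hy => hx0.trans_le hy.1)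
    fun y hy => (hf.hasDerivAt (hx0.trans hy.1)).differentiableAt.differentiableWithinAt
  rw [add_sub_cancel_left, eq_div_iff hε.ne'] at hmean
  have hP := (hnear ⟨hx0.trans hξ.1, hξ.2.trans hxR⟩).2
  have hQ := (hnear ⟨hx0, by linarith⟩).1
  rw [lt_min_iff] at hP hQ
  have hu : |ε / x| < σ := by
    rwa [abs_of_pos (by positivity), div_lt_iff₀ hx0, ← inv_mul_lt_iff₀ hσ]
  have hgap := abs_meanGap_add_sub_le (A := A) hs (by linarith [abs_lt.1 hP.2])
    (div_pos (hf.pos x hx0) hx0) hx0 hε.le (P := deriv f ξ) (Q := f x / x)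
  rw [div_mul_cancel₀ _ hx0.ne', hmean, add_sub_cancel] at hgap
  refine hgap.trans ?_
  gcongr
  exact (herror _ _ _ hP.1 hQ.1 hu).le

lemma exists_abs_integral_Ioc_shiftGap_sub_le {τ : ℝ} (hτ : 0 < τ) :
    ∃ K > 0, ∃ η > 0, ∀ᶠ q : ℝ × ℝ in shiftFilter,
      |(∫ x in Ioc (K * q.1) η, shiftGap f q.1 q.2 x) -
        q.2 * (1 - q.2) / 2 * A * (q.1 ^ 2 * Real.log (η / (K * q.1)))| ≤
          τ * (q.1 ^ 2 * Real.log (η / (K * q.1))) := by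
  obtain ⟨K, hK, R, hR, hgap⟩ := h.exists_abs_shiftGap_sub_le hf hτ
  refine ⟨K, hK, R / 2, half_pos hR, ?_⟩
  have hsmall : ∀ᶠ ε in 𝓝[>] (0 : ℝ), ε < R / 2 ∧ K * ε < R / 2 := by
    have hR2 : Iio (R / 2) ∈ 𝓝[>] (0 : ℝ) := nhdsWithin_le_nhds (Iio_mem_nhds (half_pos hR))
    exact Eventually.and hR2 (tendsto_const_mul_nhdsGT_zero hK hR2)
  filter_upwards [tendsto_fst.eventually hsmall, eventually_shiftFilter]
    with ⟨ε, s⟩ ⟨hεR, hKε⟩ ⟨hε, hs⟩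
  dsimp only at hεR hKε hε hs ⊢
  have hKε0 : 0 < K * ε := mul_pos hK hε
  have hint : IntegrableOn (fun x => ε ^ 2 * x⁻¹) (Ioc (K * ε) (R / 2)) :=
    (integrableOn_Ioc_inv hKε0).const_mul _
  have hlog : ∫ x in Ioc (K * ε) (R / 2), ε ^ 2 * x⁻¹ =
      ε ^ 2 * Real.log (R / 2 / (K * ε)) := by
    rw [integral_const_mul, ← intervalIntegral.integral_of_le hKε.le,
      integral_inv_of_pos hKε0 (half_pos hR)]
  rw [← hlog, ← integral_const_mul, ← integral_const_mul,
    ← integral_sub (integrable_shiftGap hf ε hs).integrableOn (hint.const_mul _)]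
  rw [← Real.norm_eq_abs]
  refine norm_integral_le_of_norm_le (hint.const_mul τ) ?_
  filter_upwards [ae_restrict_mem measurableSet_Ioc] with x hx
  exact hgap s hs x ε hε hx.1 (by linarith [hx.2])

lemma exists_abs_integral_Ioc_shiftGap_div_log_sub_le {τ : ℝ} (hτ : 0 < τ) :
    ∃ η > 0, ∀ᶠ q : ℝ × ℝ in shiftFilter,
      |(∫ x in Ioc 0 η, shiftGap f q.1 q.2 x) / -(q.1 ^ 2 * Real.log q.1) -
        A * q.2 * (1 - q.2) / 2| ≤ τ := by
  obtain ⟨K, hK, η, hη, houter⟩ := h.exists_abs_integral_Ioc_shiftGap_sub_le hf (half_pos hτ)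
  obtain ⟨B, hinner⟩ := h.exists_integral_Ioc_mul_shiftGap_le hf hK
  have hratio := tendsto_log_div_neg_log hη hK
  have herror : ∀ᶠ ε : ℝ in 𝓝[>] 0, B / -Real.log ε +
      τ / 2 * (Real.log (η / (K * ε)) / -Real.log ε) +
        A * |Real.log (η / (K * ε)) / -Real.log ε - 1| < τ := by
    have hlog : Tendsto (fun ε : ℝ => -Real.log ε) (𝓝[>] 0) atTop :=
      tendsto_neg_atBot_atTop.comp Real.tendsto_log_nhdsGT_zero
    refine (((hlog.const_div_atTop B).add (hratio.const_mul (τ / 2))).add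
      ((hratio.sub_const 1).abs.const_mul A)).eventually_lt_const ?_
    simpa using hτ
  have hsmall : ∀ᶠ ε in 𝓝[>] (0 : ℝ), ε < 1 ∧ K * ε < η :=
    Eventually.and (nhdsWithin_le_nhds (Iio_mem_nhds one_pos))
      (tendsto_const_mul_nhdsGT_zero hK (nhdsWithin_le_nhds (Iio_mem_nhds hη)))
  refine ⟨η, hη, ?_⟩
  filter_upwards [houter, hinner, tendsto_fst.eventually herror, tendsto_fst.eventually hsmall,
    eventually_shiftFilter] with ⟨ε, s⟩ houter hinner herror ⟨hε1, hKε⟩ ⟨hε, hs⟩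
  dsimp only at houter hinner herror hε1 hKε hε hs ⊢
  have hℓ : 0 < -Real.log ε := neg_pos.2 (Real.log_neg hε hε1)
  have hA := h.A_pos
  have hw : A * s * (1 - s) / 2 ∈ Icc 0 A := by
    constructor <;> nlinarith [mul_pos hA hs.1, mul_pos hA (sub_pos.2 hs.2),
      mul_pos (mul_pos hA hs.1) (sub_pos.2 hs.2), sq_nonneg s]
  have hint : ∀ S, IntegrableOn (shiftGap f ε s) S := fun S =>
    (integrable_shiftGap hf ε hs).integrableOn
  have hε2 : 0 < ε ^ 2 := by positivity
  rw [Real.rpow_two, mul_comm B] at hinner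
  rw [show s * (1 - s) / 2 * A = A * s * (1 - s) / 2 by ring] at houter
  have hsum := abs_add_div_sub_le (mul_pos hε2 hℓ)
    ⟨integral_nonneg fun x => shiftGap_nonneg hf hs, hinner⟩ houter hw
  rw [mul_div_mul_left _ _ hε2.ne', mul_div_mul_left _ _ hε2.ne'] at hsum
  rw [← Ioc_union_Ioc_eq_Ioc (mul_pos hK hε).le hKε.le, setIntegral_union
    (Ioc_disjoint_Ioc_of_le le_rfl) measurableSet_Ioc (hint _) (hint _), ← mul_neg]
  exact hsum.trans herror.le

lemma tendsto_deficit_div_of_eq_two (ht : TailCondition f) :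
    Tendsto (fun q : ℝ × ℝ => deficit f q.1 q.2 / -(q.1 ^ 2 * Real.log q.1) -
      A * q.2 * (1 - q.2) / 2) shiftFilter (𝓝 0) := by
  have hsq : Tendsto (fun ε : ℝ => ε ^ 2 / -(ε ^ 2 * Real.log ε)) (𝓝[>] 0) (𝓝 0) := by
    refine ((tendsto_neg_atBot_atTop.comp Real.tendsto_log_nhdsGT_zero).const_div_atTop 1).congr' ?_
    filter_upwards [self_mem_nhdsWithin] with ε (hε : 0 < ε)
    rw [Function.comp_apply, ← mul_neg, div_mul_eq_div_div, div_self (by positivity)]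
  refine tendsto_deficit_div_of_near (L := fun s => A * s * (1 - s) / 2) hf ht hsq
    (h.tendsto_integral_Ioc_div_zero hf (by simpa only [Real.rpow_two] using hsq)) fun τ hτ => ?_
  obtain ⟨η, hη, hnear⟩ := h.exists_abs_integral_Ioc_shiftGap_div_log_sub_le hf hτ
  exact ⟨η, hη, by simpa only [mul_zero, zero_mul, sub_zero] using hnear⟩

lemma uniformLimit_of_eq_two (ht : TailCondition f) (θ : ℝ) :
    UniformLimit
      (fun ε s => relRenyi s (shift f θ) (shift f (θ + ε)) / -(ε ^ 2 * Real.log ε))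
      (fun s => A * s * (1 - s) / 2) := by
  have hpos : ∀ᶠ ε : ℝ in 𝓝[>] 0, 0 < -(ε ^ 2 * Real.log ε) := by
    filter_upwards [Ioo_mem_nhdsGT one_pos] with ε hε
    exact neg_pos.2 (mul_neg_of_pos_of_neg (pow_pos hε.1 2) (Real.log_neg hε.1 hε.2))
  have hzero : Tendsto (fun ε : ℝ => -(ε ^ 2 * Real.log ε)) (𝓝[>] 0) (𝓝 0) := by
    simpa [mul_comm] using (tendsto_log_mul_rpow_nhdsGT_zero two_pos).neg
  exact uniformLimit_relRenyi hf hpos hzero (h.tendsto_deficit_div_of_eq_two hf ht) θ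

end FirstOrderEndpoint

/-! ### Weibull and gamma densities -/

lemma integrableOn_supShift_mul {g h G H : ℝ → ℝ} {c δ : ℝ} (hc : 0 < c)
    (hg : ContinuousOn g (Ioi 0)) (hh : ContinuousOn h (Ioi 0)) (hg0 : ∀ x > 0, 0 ≤ g x)
    (hh0 : ∀ x > 0, 0 ≤ h x) (hG : ∀ x > c, supShift δ g x ≤ G x)
    (hH : ∀ x > c, supShift δ h x ≤ H x) (hGH : IntegrableOn (fun x => G x * H x) (Ioi c)) :
    IntegrableOn (fun x => supShift δ g x * supShift δ h x) (Ioi c) := by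
  have hnonneg : ∀ {k : ℝ → ℝ}, (∀ x > 0, 0 ≤ k x) → ∀ x > c, 0 ≤ supShift δ k x :=
    fun hk x hx => Real.iSup_nonneg fun t => hk _ (by linarith [t.2.1])
  refine hGH.mono' ((((continuousOn_supShift hg δ).mul (continuousOn_supShift hh δ)).mono
    (Ioi_subset_Ioi hc.le)).aestronglyMeasurable measurableSet_Ioi) ?_
  filter_upwards [ae_restrict_mem measurableSet_Ioi] with x hx
  rw [Real.norm_of_nonneg (mul_nonneg (hnonneg hg0 x hx) (hnonneg hh0 x hx))]
  exact mul_le_mul (hG x hx) (hH x hx) (hnonneg hh0 x hx) ((hnonneg hg0 x hx).trans (hG x hx))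

lemma exists_abs_eval_le (p : Polynomial ℝ) :
    ∃ B, 0 ≤ B ∧ ∀ v ≥ 1, |p.eval v| ≤ B * v ^ p.natDegree := by
  refine ⟨∑ i ∈ Finset.range (p.natDegree + 1), |p.coeff i|, by positivity, fun v hv => ?_⟩
  rw [Polynomial.eval_eq_sum_range, Finset.sum_mul]
  refine (Finset.abs_sum_le_sum_abs _ _).trans (Finset.sum_le_sum fun i hi => ?_)
  rw [abs_mul, abs_of_nonneg (by positivity : 0 ≤ v ^ i)]
  gcongr
  exact Finset.mem_range_succ_iff.1 hi

lemma abs_div_pow_le_abs {a x : ℝ} (hx : 1 ≤ x) (k : ℕ) : |a / x ^ k| ≤ |a| := by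
  rw [abs_div, abs_of_nonneg (by positivity : 0 ≤ x ^ k)]
  exact div_le_self (abs_nonneg a) (one_le_pow₀ hx)

/-- The unnormalized generalized gamma density `C x^(α-1) exp(-β x^γ)` on the half-line, which
comprises the Weibull (`γ = α`) and the gamma (`γ = 1`) densities. -/
noncomputable def genGamma (C α β γ x : ℝ) : ℝ :=
  if 0 ≤ x then C * x ^ (α - 1) * Real.exp (-(β * x ^ γ)) else 0

namespace genGamma

/-- The polynomial `P` with `x ^ k * f⁽ᵏ⁾(x) = f(x) * P(x ^ γ)` for `f = genGamma C α β γ`. -/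
noncomputable def derivPoly (α β γ : ℝ) : ℕ → Polynomial ℝ
  | 0 => 1
  | k + 1 => (.C (α - 1 - k) - .C (β * γ) * .X) * derivPoly α β γ k +
      .C γ * .X * (derivPoly α β γ k).derivative

lemma derivPoly_one (α β γ : ℝ) : derivPoly α β γ 1 = .C (α - 1) - .C (β * γ) * .X := by
  simp [derivPoly]

lemma derivPoly_two (α β γ : ℝ) : derivPoly α β γ 2 =
    (.C (α - 2) - .C (β * γ) * .X) * (.C (α - 1) - .C (β * γ) * .X) -
      .C (β * γ ^ 2) * .X := by
  have hsub : α - 1 - ((1 : ℕ) : ℝ) = α - 2 := by push_cast; ring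
  rw [derivPoly, derivPoly_one, hsub]
  simp only [Polynomial.derivative_sub, Polynomial.derivative_C, Polynomial.derivative_mul,
    Polynomial.derivative_X, map_mul, map_pow]
  ring

variable {C α β γ x : ℝ}

lemma of_pos (hx : 0 < x) :
    genGamma C α β γ x = C * x ^ (α - 1) * Real.exp (-(β * x ^ γ)) := if_pos hx.le

lemma of_neg (hx : x < 0) : genGamma C α β γ x = 0 := if_neg hx.not_ge

lemma pos (hC : 0 < C) (hx : 0 < x) : 0 < genGamma C α β γ x := by
  rw [of_pos hx]; positivity

lemma hasDerivAt_rpow (hx : 0 < x) (p : ℝ) : HasDerivAt (fun x => x ^ p) (p * x ^ p / x) x := by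
  have hderiv := Real.hasDerivAt_rpow_const (p := p) (.inl hx.ne')
  rwa [Real.rpow_sub hx, Real.rpow_one, ← mul_div_assoc] at hderiv

lemma hasDerivAt (hx : 0 < x) :
    HasDerivAt (genGamma C α β γ) (genGamma C α β γ x * (α - 1 - β * γ * x ^ γ) / x) x := by
  have hderiv := ((hasDerivAt_rpow hx (α - 1)).const_mul C).mul
    ((hasDerivAt_rpow hx γ).const_mul β).fun_neg.exp
  refine (hderiv.congr_of_eventuallyEq ?_).congr_deriv ?_
  · filter_upwards [Ioi_mem_nhds hx] with y hy using of_pos hy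
  · rw [of_pos hx]
    field_simp
    ring

lemma hasDerivAt_mul_derivPoly_div (hx : 0 < x) (k : ℕ) :
    HasDerivAt (fun x => genGamma C α β γ x * (derivPoly α β γ k).eval (x ^ γ) / x ^ k)
      (genGamma C α β γ x * (derivPoly α β γ (k + 1)).eval (x ^ γ) / x ^ (k + 1)) x := by
  have hpoly := ((derivPoly α β γ k).hasDerivAt (x ^ γ)).comp x (hasDerivAt_rpow hx γ)
  have hpow : HasDerivAt (fun x : ℝ => x ^ k) (k * x ^ k / x) x := by
    simpa only [Real.rpow_natCast] using hasDerivAt_rpow hx k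
  refine (((hasDerivAt hx).fun_mul hpoly).fun_div hpow (pow_ne_zero k hx.ne')).congr_deriv ?_
  simp only [derivPoly, Function.comp_apply, Polynomial.eval_add, Polynomial.eval_sub,
    Polynomial.eval_mul, Polynomial.eval_C, Polynomial.eval_X]
  field_simp
  ring

lemma iteratedDeriv_eq (k : ℕ) (hx : 0 < x) : iteratedDeriv k (genGamma C α β γ) x =
    genGamma C α β γ x * (derivPoly α β γ k).eval (x ^ γ) / x ^ k := by
  induction k generalizing x with
  | zero => simp [derivPoly]
  | succ k ih =>
    rw [iteratedDeriv_succ]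
    refine ((hasDerivAt_mul_derivPoly_div hx k).congr_of_eventuallyEq ?_).deriv
    filter_upwards [Ioi_mem_nhds hx] with y hy using ih hy

lemma deriv_eq (hx : 0 < x) : deriv (genGamma C α β γ) x =
    genGamma C α β γ x * (derivPoly α β γ 1).eval (x ^ γ) / x := by
  rw [← iteratedDeriv_one, iteratedDeriv_eq 1 hx, pow_one]

lemma contDiffOn : ContDiffOn ℝ 3 (genGamma C α β γ) (Ioi 0) := by
  have hrpow : ∀ p : ℝ, ContDiffOn ℝ 3 (fun x : ℝ => x ^ p) (Ioi 0) := fun p =>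
    contDiffOn_id.rpow_const_of_ne fun x hx => ne_of_gt hx
  exact ((contDiffOn_const.mul (hrpow _)).mul (contDiffOn_const.mul (hrpow γ)).neg.exp).congr
    fun x hx => of_pos hx

lemma integrableOn_rpow_mul_exp (hβ : 0 < β) (hγ : 0 < γ) {p : ℝ} (hp : -1 < p) :
    IntegrableOn (fun x : ℝ => x ^ p * Real.exp (-(β * x ^ γ))) (Ioi 0) := by
  simpa only [neg_mul] using integrableOn_rpow_mul_exp_neg_mul_rpow hp hγ hβ

lemma integral_Ioi (hβ : 0 < β) (hγ : 0 < γ) (hα : 0 < α) :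
    ∫ x in Ioi 0, genGamma C α β γ x = C * (β ^ (-α / γ) * (1 / γ) * Real.Gamma (α / γ)) := by
  have hGamma := integral_rpow_mul_exp_neg_mul_rpow hγ (by linarith : -1 < α - 1) hβ
  rw [sub_add_cancel] at hGamma
  rw [← hGamma, ← integral_const_mul]
  refine setIntegral_congr_fun measurableSet_Ioi fun x hx => ?_
  simp only [of_pos (mem_Ioi.1 hx), mul_assoc, neg_mul]

lemma isHalfLineDensity (hC : 0 < C) (hα : 0 < α) (hβ : 0 < β) (hγ : 0 < γ)
    (hone : C * (β ^ (-α / γ) * (1 / γ) * Real.Gamma (α / γ)) = 1) :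
    IsHalfLineDensity (genGamma C α β γ) where
  nonneg x := by
    unfold genGamma; split_ifs <;> positivity
  eq_zero x hx := of_neg hx
  pos x hx := pos hC hx
  integrable := by
    refine (integrableOn_iff_integrable_of_support_subset (s := Ici 0) fun x hx => ?_).1 ?_
    · exact not_lt.1 fun hneg => hx (of_neg hneg)
    · rw [integrableOn_Ici_iff_integrableOn_Ioi]
      refine IntegrableOn.congr_fun (Integrable.const_mul
        (integrableOn_rpow_mul_exp hβ hγ (by linarith : -1 < α - 1)) C) (fun x hx => ?_)
        measurableSet_Ioi
      simp only [of_pos (mem_Ioi.1 hx), mul_assoc]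
  integral_eq_one := by
    rw [← hone, ← integral_Ioi hβ hγ hα, ← integral_Ici_eq_integral_Ioi,
      setIntegral_eq_integral_of_forall_compl_eq_zero]
    exact fun x hx => of_neg (not_le.1 hx)
  contDiffOn := contDiffOn

lemma tendsto_exp (hγ : 0 < γ) :
    Tendsto (fun x : ℝ => Real.exp (-(β * x ^ γ))) (𝓝[>] 0) (𝓝 1) := by
  simpa using ((tendsto_rpow_nhdsGT_zero hγ).const_mul β).neg.rexp

lemma tendsto_eval (hγ : 0 < γ) (p : Polynomial ℝ) :
    Tendsto (fun x : ℝ => p.eval (x ^ γ)) (𝓝[>] 0) (𝓝 (p.eval 0)) :=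
  (p.continuous.tendsto 0).comp (tendsto_rpow_nhdsGT_zero hγ)

lemma iteratedDeriv_isEquivalent (hγ : 0 < γ) (k : ℕ) (hk : (derivPoly α β γ k).eval 0 ≠ 0) :
    iteratedDeriv k (genGamma C α β γ) ~[𝓝[>] 0]
      fun x => C * (derivPoly α β γ k).eval 0 * x ^ (α - 1 - k) := by
  have hratio := (tendsto_exp (β := β) hγ).mul
    ((tendsto_eval hγ (derivPoly α β γ k)).div_const ((derivPoly α β γ k).eval 0))
  rw [div_self hk, mul_one] at hratio
  refine isEquivalent_iff_exists_eq_mul.2 ⟨_, hratio, ?_⟩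
  filter_upwards [self_mem_nhdsWithin] with x (hx : 0 < x)
  rw [iteratedDeriv_eq k hx, of_pos hx, Pi.mul_apply, Real.rpow_sub hx (α - 1) k, Real.rpow_natCast]
  field_simp

lemma tendsto_mul_iteratedDeriv_two (hγ : 0 < γ) :
    Tendsto (fun x => x * iteratedDeriv 2 (genGamma C 2 β γ) x) (𝓝[>] 0) (𝓝 0) := by
  have hlim := ((tendsto_exp (β := β) hγ).mul (tendsto_eval hγ (derivPoly 2 β γ 2))).const_mul C
  rw [derivPoly_two] at hlim
  simp only [sub_self, map_zero, zero_sub, Polynomial.eval_sub, Polynomial.eval_mul,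
    Polynomial.eval_neg, Polynomial.eval_X, mul_zero, neg_zero, zero_mul] at hlim
  refine hlim.congr' ?_
  filter_upwards [self_mem_nhdsWithin] with x (hx : 0 < x)
  rw [iteratedDeriv_eq 2 hx, of_pos hx, derivPoly_two, show (2 : ℝ) - 1 = 1 by norm_num,
    Real.rpow_one]
  simp only [map_mul, map_pow, sub_self, map_zero, zero_sub, Polynomial.eval_sub,
    Polynomial.eval_mul, Polynomial.eval_neg, Polynomial.eval_pow, Polynomial.eval_C,
    Polynomial.eval_X]
  field_simp

lemma endpointCondition (hC : 0 < C) (hα : 0 < α) (hγ : 0 < γ) (hαγ : α = 1 → γ = 1) :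
    EndpointCondition (genGamma C α β γ) C α where
  A_pos := hC
  kappa_pos := hα
  equiv := by
    simpa [derivPoly] using iteratedDeriv_isEquivalent (C := C) (α := α) (β := β) hγ 0
      (by simp [derivPoly])
  equiv_deriv hκ := by
    have heval : (derivPoly α β γ 1).eval 0 = α - 1 := by simp [derivPoly_one]
    have hequiv := iteratedDeriv_isEquivalent (C := C) (α := α) (β := β) hγ 1
      (by rw [heval]; exact sub_ne_zero.2 hκ)
    rw [heval, iteratedDeriv_one] at hequiv
    convert! hequiv using 4
    push_cast
    ring
  equiv_deriv2 hκ hκ2 := by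
    have heval : (derivPoly α β γ 2).eval 0 = (α - 1) * (α - 2) := by
      simp [derivPoly_two, mul_comm]
    have hequiv := iteratedDeriv_isEquivalent (C := C) (α := α) (β := β) hγ 2
      (by rw [heval]; exact mul_ne_zero (sub_ne_zero.2 hκ) (sub_ne_zero.2 hκ2))
    rw [heval, ← mul_assoc] at hequiv
    convert! hequiv using 4
    push_cast
    ring
  tendsto_of_two hκ := hκ ▸ tendsto_mul_iteratedDeriv_two hγ
  limit_deriv_of_one hκ := by
    refine ⟨_, ((tendsto_exp (β := β) hγ).const_mul (-(C * β))).congr' ?_⟩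
    filter_upwards [self_mem_nhdsWithin] with x (hx : 0 < x)
    rw [deriv_eq hx, of_pos hx, derivPoly_one, hκ, hαγ hκ]
    simp only [Real.rpow_one, sub_self, Real.rpow_zero, mul_one, map_zero, zero_sub,
      Polynomial.eval_neg, Polynomial.eval_mul, Polynomial.eval_C, Polynomial.eval_X]
    field_simp
  limit_deriv2_of_one hκ := by
    refine ⟨_, ((tendsto_exp (β := β) hγ).const_mul (C * β ^ 2)).congr' ?_⟩
    filter_upwards [self_mem_nhdsWithin] with x (hx : 0 < x)
    rw [iteratedDeriv_eq 2 hx, of_pos hx, derivPoly_two, hκ, hαγ hκ]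
    simp only [Real.rpow_one, sub_self, Real.rpow_zero, mul_one, map_zero, zero_sub, one_pow,
      Polynomial.eval_sub, Polynomial.eval_mul, Polynomial.eval_neg, Polynomial.eval_C,
      Polynomial.eval_X]
    field_simp
    ring

lemma supShift_le (hC : 0 < C) (hβ : 0 < β) (hγ : 0 < γ) (hx : 1 < x) :
    supShift 1 (genGamma C α β γ) x ≤ C * (2 * x) ^ |α - 1| * Real.exp (-(β * x ^ γ)) := by
  refine Real.iSup_le (fun ⟨t, ht⟩ => ?_) (by positivity)
  obtain ⟨ht0, ht1⟩ := ht
  have hpow : (x + t) ^ (α - 1) ≤ (2 * x) ^ |α - 1| :=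
    calc (x + t) ^ (α - 1) ≤ (x + t) ^ |α - 1| :=
          Real.rpow_le_rpow_of_exponent_le (by linarith) (le_abs_self _)
      _ ≤ (2 * x) ^ |α - 1| := by gcongr; linarith
  rw [of_pos (by linarith)]
  gcongr
  linarith

lemma supShift_le_of_le_eval (hγ : 0 < γ) {h : ℝ → ℝ} {p : Polynomial ℝ} {B : ℝ} (hB : 0 ≤ B)
    (hpB : ∀ v ≥ 1, |p.eval v| ≤ B * v ^ p.natDegree) (hp : ∀ x ≥ 1, h x ≤ |p.eval (x ^ γ)|)
    (hx : 1 < x) : supShift 1 h x ≤ B * ((2 * x) ^ γ) ^ p.natDegree := by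
  refine Real.iSup_le (fun ⟨t, ht⟩ => ?_) (by positivity)
  obtain ⟨ht0, ht1⟩ := ht
  have hxt : 1 ≤ x + t := by linarith
  calc h (x + t) ≤ B * ((x + t) ^ γ) ^ p.natDegree :=
        (hp _ hxt).trans (hpB _ (Real.one_le_rpow hxt hγ.le))
    _ ≤ B * ((2 * x) ^ γ) ^ p.natDegree := by gcongr; linarith

lemma integrableOn_supShift_mul_of_le_eval (hC : 0 < C) (hβ : 0 < β) (hγ : 0 < γ) {h : ℝ → ℝ}
    (hh : ContinuousOn h (Ioi 0)) (hh0 : ∀ x > 0, 0 ≤ h x) (p : Polynomial ℝ)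
    (hp : ∀ x ≥ 1, h x ≤ |p.eval (x ^ γ)|) :
    IntegrableOn (fun x => supShift 1 (genGamma C α β γ) x * supShift 1 h x) (Ioi 1) := by
  obtain ⟨B, hB, hpB⟩ := exists_abs_eval_le p
  refine integrableOn_supShift_mul one_pos contDiffOn.continuousOn hh (fun x hx => (pos hC hx).le)
    hh0 (fun x => supShift_le hC hβ hγ) (fun x => supShift_le_of_le_eval hγ hB hpB hp) ?_
  have hmoment := (integrableOn_rpow_mul_exp hβ hγ (p := |α - 1| + γ * p.natDegree)
    (neg_one_lt_zero.trans_le (by positivity))).mono_set (Ioi_subset_Ioi zero_le_one)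
  refine IntegrableOn.congr_fun (Integrable.const_mul hmoment
    (C * B * 2 ^ |α - 1| * (2 ^ γ) ^ p.natDegree)) (fun x hx => ?_) measurableSet_Ioi
  have hx0 : 0 < x := one_pos.trans hx
  simp only [Real.mul_rpow zero_le_two hx0.le, Real.rpow_add hx0, Real.rpow_mul_natCast hx0.le]
  ring

lemma inv_mul_deriv_sq_eq (hC : 0 < C) (hx : 0 < x) :
    (genGamma C α β γ x)⁻¹ * deriv (genGamma C α β γ) x ^ 2 =
      genGamma C α β γ x * ((derivPoly α β γ 1 ^ 2).eval (x ^ γ) / x ^ 2) := by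
  have hfx := pos (α := α) (β := β) (γ := γ) hC hx
  rw [deriv_eq hx, Polynomial.eval_pow]
  field_simp

lemma integrableOn_inv_mul_deriv_sq (hf : IsHalfLineDensity (genGamma C α β γ)) (hC : 0 < C)
    (hβ : 0 < β) (hγ : 0 < γ) :
    IntegrableOn (fun x => (genGamma C α β γ x)⁻¹ * deriv (genGamma C α β γ) x ^ 2) (Ioi 1) := by
  set p := derivPoly α β γ 1 ^ 2
  have hcont : ContinuousOn (fun x : ℝ => |p.eval (x ^ γ)|) (Ioi 0) :=
    (p.continuous.comp_continuousOn
      (continuousOn_id.rpow_const fun x hx => .inl (ne_of_gt hx))).abs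
  refine (integrableOn_supShift_mul_of_le_eval (α := α) hC hβ hγ hcont
    (fun _ _ => abs_nonneg _) p fun _ _ => le_rfl).mono'
    ((hf.continuousOn_inv_mul_deriv_sq.mono (Ioi_subset_Ioi zero_le_one)).aestronglyMeasurable
      measurableSet_Ioi) ?_
  filter_upwards [ae_restrict_mem measurableSet_Ioi] with x (hx : 1 < x)
  have hx0 : 0 < x := one_pos.trans hx
  have hsup : ∀ {k : ℝ → ℝ}, ContinuousOn k (Ioi 0) → k x ≤ supShift 1 k x := fun hk => by
    simpa only [add_zero] using le_supShift hk hx0 (left_mem_Icc.2 zero_le_one)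
  have hfx := pos (α := α) (β := β) (γ := γ) hC hx0
  rw [inv_mul_deriv_sq_eq hC hx0, norm_mul, Real.norm_of_nonneg hfx.le, Real.norm_eq_abs]
  exact mul_le_mul (hsup hf.continuousOn) ((abs_div_pow_le_abs hx.le 2).trans (hsup hcont))
    (abs_nonneg _) (hfx.le.trans (hsup hf.continuousOn))

lemma tailCondition (hf : IsHalfLineDensity (genGamma C α β γ)) (hC : 0 < C) (hβ : 0 < β)
    (hγ : 0 < γ) : TailCondition (genGamma C α β γ) := by
  refine ⟨1, one_pos, 1, one_pos, integrableOn_inv_mul_deriv_sq hf hC hβ hγ,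
    integrableOn_supShift_mul_of_le_eval hC hβ hγ hf.continuousOn_abs_deriv_pow_three
      (fun _ _ => abs_nonneg _) (derivPoly α β γ 1 ^ 3) fun x hx => ?_,
    integrableOn_supShift_mul_of_le_eval hC hβ hγ hf.continuousOn_abs_deriv_mul_deriv_two
      (fun _ _ => abs_nonneg _) (derivPoly α β γ 1 * derivPoly α β γ 2) fun x hx => ?_,
    integrableOn_supShift_mul_of_le_eval hC hβ hγ hf.continuousOn_abs_deriv_three
      (fun _ _ => abs_nonneg _) (derivPoly α β γ 3) fun x hx => ?_⟩
  all_goals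
    have hx0 : 0 < x := one_pos.trans_le hx
    have hfx := pos (α := α) (β := β) (γ := γ) hC hx0
    refine (congrArg abs ?_).trans_le (abs_div_pow_le_abs hx 3)
    simp only [deriv_eq hx0, iteratedDeriv_eq _ hx0, Polynomial.eval_mul, Polynomial.eval_pow]
    field_simp

lemma admissible (hC : 0 < C) (hα : 0 < α) (hβ : 0 < β) (hγ : 0 < γ) (hαγ : α = 1 → γ = 1)
    (hone : C * (β ^ (-α / γ) * (1 / γ) * Real.Gamma (α / γ)) = 1) :
    Admissible (genGamma C α β γ) C α :=
  have hf := isHalfLineDensity hC hα hβ hγ hone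
  ⟨hf, endpointCondition hC hα hγ hαγ, tailCondition hf hC hβ hγ⟩

end genGamma

lemma admissible_weibullPDF {α β : ℝ} (hα : 0 < α) (hβ : 0 < β) :
    Admissible (weibullPDF α β) (α * β) α := by
  refine genGamma.admissible (by positivity) hα hβ hα id ?_
  rw [neg_div, div_self hα.ne', Real.rpow_neg_one, Real.Gamma_one]
  field_simp

lemma gammaPDFReal_eq_genGamma (α β : ℝ) :
    ProbabilityTheory.gammaPDFReal α β = genGamma (β ^ α / Real.Gamma α) α β 1 := by
  ext x
  simp [ProbabilityTheory.gammaPDFReal, genGamma]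

lemma admissible_gammaPDFReal {α β : ℝ} (hα : 0 < α) (hβ : 0 < β) :
    Admissible (ProbabilityTheory.gammaPDFReal α β) (β ^ α / Real.Gamma α) α := by
  have hΓ := Real.Gamma_pos_of_pos hα
  rw [gammaPDFReal_eq_genGamma]
  refine genGamma.admissible (by positivity) hα hβ one_pos (fun _ => rfl) ?_
  rw [div_one, div_one, Real.rpow_neg hβ.le]
  field_simp [(Real.rpow_pos_of_pos hβ α).ne', hΓ.ne']

end LocationShift

theorem theorem2_general {f : ℝ → ℝ} {A κ : ℝ} (hf : LocationShift.IsHalfLineDensity f)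
    (h : LocationShift.FirstOrderEndpoint f A κ) (ht : LocationShift.TailCondition f) (θ : ℝ) :
    (κ < 1 → LocationShift.UniformLimit
      (fun ε s => LocationShift.relRenyi s (LocationShift.shift f θ)
        (LocationShift.shift f (θ + ε)) / ε ^ κ)
      (fun s => (1 - κ) / κ *
        (A * s * ProbabilityTheory.beta (s + κ * (1 - s)) (1 - κ)))) ∧
    (κ = 1 → LocationShift.UniformLimit
      (fun ε s => LocationShift.relRenyi s (LocationShift.shift f θ)
        (LocationShift.shift f (θ + ε)) / ε ^ κ)
      (fun s => A * s)) ∧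
    (1 < κ → κ < 2 → LocationShift.UniformLimit
      (fun ε s => LocationShift.relRenyi s (LocationShift.shift f θ)
        (LocationShift.shift f (θ + ε)) / ε ^ κ)
      (fun s => A * s * (1 - s * (κ - 1)) *
        ProbabilityTheory.beta (s + κ * (1 - s)) (2 - κ) / κ)) ∧
    (κ = 2 → LocationShift.UniformLimit
      (fun ε s => LocationShift.relRenyi s (LocationShift.shift f θ)
        (LocationShift.shift f (θ + ε)) / (-(ε ^ 2 * Real.log ε)))
      (fun s => A * s * (1 - s) / 2)) ∧
    (2 < κ →
      IntegrableOn (fun x => (f x)⁻¹ * deriv f x ^ 2) (Ioi 0) ∧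
      LocationShift.UniformLimit
        (fun ε s => LocationShift.relRenyi s (LocationShift.shift f θ)
          (LocationShift.shift f (θ + ε)) / ε ^ 2)
        (fun s => s * (1 - s) / 2 * LocationShift.fisherInfo f)) := by
  refine ⟨fun hκ => h.uniformLimit_of_lt_one hf ht hκ θ,
    fun hκ => h.uniformLimit_of_eq_one hf ht hκ θ,
    fun _ hκ => h.uniformLimit_of_lt_two hf ht hκ θ, ?_,
    fun hκ => ⟨h.integrableOn_inv_mul_deriv_sq hf ht hκ, h.uniformLimit_of_two_lt hf ht hκ θ⟩⟩
  rintro rfl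
  exact h.uniformLimit_of_eq_two hf ht θ

theorem theorem2 :
    (∀ (f : ℝ → ℝ) (A κ : ℝ), LocationShift.Admissible f A κ → ∀ θ : ℝ,
      (κ < 1 → LocationShift.UniformLimit
        (fun ε s => LocationShift.relRenyi s (LocationShift.shift f θ)
          (LocationShift.shift f (θ + ε)) / ε ^ κ)
        (fun s => (1 - κ) / κ *
          (A * s * ProbabilityTheory.beta (s + κ * (1 - s)) (1 - κ)))) ∧
      (κ = 1 → LocationShift.UniformLimit
        (fun ε s => LocationShift.relRenyi s (LocationShift.shift f θ)
          (LocationShift.shift f (θ + ε)) / ε ^ κ)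
        (fun s => A * s)) ∧
      (1 < κ → κ < 2 → LocationShift.UniformLimit
        (fun ε s => LocationShift.relRenyi s (LocationShift.shift f θ)
          (LocationShift.shift f (θ + ε)) / ε ^ κ)
        (fun s => A * s * (1 - s * (κ - 1)) *
          ProbabilityTheory.beta (s + κ * (1 - s)) (2 - κ) / κ)) ∧
      (κ = 2 → LocationShift.UniformLimit
        (fun ε s => LocationShift.relRenyi s (LocationShift.shift f θ)
          (LocationShift.shift f (θ + ε)) / (-(ε ^ 2 * Real.log ε)))
        (fun s => A * s * (1 - s) / 2)) ∧
      (2 < κ →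
        IntegrableOn (fun x => (f x)⁻¹ * deriv f x ^ 2) (Ioi 0) ∧
        LocationShift.UniformLimit
          (fun ε s => LocationShift.relRenyi s (LocationShift.shift f θ)
            (LocationShift.shift f (θ + ε)) / ε ^ 2)
          (fun s => s * (1 - s) / 2 * LocationShift.fisherInfo f))) ∧
    (∀ α β : ℝ, 0 < α → 0 < β →
      LocationShift.Admissible (LocationShift.weibullPDF α β) (α * β) α) ∧
    (∀ α β : ℝ, 0 < α → 0 < β →
      LocationShift.Admissible (ProbabilityTheory.gammaPDFReal α β)
        (β ^ α / Real.Gamma α) α) := by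
  exact ⟨fun f A κ h => theorem2_general h.density h.endpoint.firstOrder h.tail,
    fun _ _ => LocationShift.admissible_weibullPDF,
    fun _ _ => LocationShift.admissible_gammaPDFReal⟩
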